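/- Let $n\ge 3$ and let $X_1,\dots,X_n$ be independent random variables with common distribution $F$, where $F$ is concentrated on $(0,\infty)$ and has there a density that is continuous and strictly positive. Let $X_{(1)}\le\cdots\le X_{(n)}$ be the order statistics and $\overline X_n=\frac1n\sum_{i=1}^n X_i$ the sample mean. Let $a_1\le a_2\le\cdots\le a_n$ be arbitrary real numbers, not all equal, and set $$Z_n=\sum_{i=1}^n a_i\,(X_{(i)}-\overline X_n).$$ Then $\overline X_n$ and $Z_n/\overline X_n$ are independent if and only if $F$ is a gamma distribution, that is, if and only if there are $a,b>0$ such that $F$ has density $\frac{1}{\Gamma(a)b^a}x^{a-1}e^{-x/b}$ for $x>0$ (and $0$ for $x\le 0$). In particular, the same equivalence holds when $Z_n$ is replaced by the sample range $R_n=X_{(n)}-X_{(1)}$, and when it is replaced by Gini's mean difference $G_n=\frac{1}{n(n-1)}\sum_{i=1}^n\sum_{j=1}^n|X_i-X_j|$. -/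

import Mathlib

open MeasureTheory ProbabilityTheory Set

noncomputable section

/-- The law `F` is concentrated on `(0, ∞)` and has there a positive continuous density. -/
def HasPositiveContinuousDensity (F : Measure ℝ) : Prop :=
  ∃ f : ℝ → ℝ, ContinuousOn f (Ioi 0) ∧ (∀ x, 0 < x → 0 < f x) ∧
    F = (volume.restrict (Ioi 0)).withDensity (fun x => ENNReal.ofReal (f x))

/-- `F` is a gamma distribution, of shape `a` and scale `b`
(the second parameter of Mathlib's `gammaMeasure` is the rate). -/
def IsGammaDistribution (F : Measure ℝ) : Prop :=
  ∃ a b : ℝ, 0 < a ∧ 0 < b ∧ F = gammaMeasure a b⁻¹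

/-- The mean of the sample `x`. -/
def sampleMean {n : ℕ} (x : Fin n → ℝ) : ℝ :=
  (∑ i, x i) / n

/-- The order statistics of the sample `x`: its values in nondecreasing order. -/
def orderStat {n : ℕ} (x : Fin n → ℝ) : Fin n → ℝ :=
  x ∘ Tuple.sort x

/-- The statistic `∑ a i * (x_(i) - mean)`. -/
def orderedDeviation {n : ℕ} (a x : Fin n → ℝ) : ℝ :=
  ∑ i, a i * (orderStat x i - sampleMean x)

/-- The sample range: the largest minus the smallest order statistic. -/
def sampleRange {n : ℕ} (hn : 0 < n) (x : Fin n → ℝ) : ℝ :=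
  orderStat x ⟨n - 1, Nat.sub_lt hn Nat.one_pos⟩ - orderStat x ⟨0, hn⟩

/-- Gini's mean difference. -/
def giniMeanDifference {n : ℕ} (x : Fin n → ℝ) : ℝ :=
  1 / ((n : ℝ) * ((n : ℝ) - 1)) * ∑ i, ∑ j, |x i - x j|

end

/-!
Nothing is used about the three statistics beyond the following: they are continuous, nonnegative,
positively homogeneous, translation invariant, and vanish only on constant samples
(`IsDispersion`). Let `D` be such a statistic. A sample `x` of positive mean `t` is written as
`x i = t * (1 + v i)`, with `v` in the hyperplane `centered n` of vectors with zero sum. In these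
coordinates the mean is `t`, the quotient of `D` by the mean is `D v`, and Lebesgue measure is a
constant times `t ^ d dt dv` (`exists_lintegral_eq_polar`), so the joint law of mean and quotient is
explicit (`exists_joint_law`).

*A gamma law gives independence.* Since `∑ v i = 0`, the exponential factor of the joint density
depends on `t` only, and the density is a product of a function of `t` and a function of `v`.

*Independence gives a gamma law.* Let `f` be the density. Independence says that
`I ε t = ∫ ∏ f (t * (1 + v i)) dv`, taken over `{D v ≤ ε}`, is for almost every `t` a constant
depending on `ε` times a function of `t` alone. Both sides of the resulting proportionality
`I ε t ∝ I ε' t` are continuous in `t`, and the averages `I ε' t / |{D v ≤ ε'}|` tend to `f t ^ n`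
as `ε' → 0`. Hence `I ε t = f t ^ n * M ε` for all `t > 0` and all small `ε`
(`IsDispersion.eventually_integral_eq_pow_mul`).

For twice differentiable `f`, an expansion in `ε` would show that `t² (log f)''` is constant. As `f`
is only continuous, a comparison argument in the spirit of viscosity solutions is used instead.
The functions `x ^ (-l) * exp (β x)` satisfy the same identity exactly, with the constant
`powerAverage D l ε`, which is strictly increasing in `l` (by `∏ (1 + v i) < 1` for `v ≠ 0`). If
`log f + l log` is not convex, it has an interior local maximum after subtraction of a linear
function, and there the identity forces `M ε ≤ powerAverage D l ε` for small `ε`; if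
`log f + l' log` is not concave, then likewise `powerAverage D l' ε ≤ M ε`. Both cannot happen with
`l < l'`, so at a critical value of `l` the function `log f + l log` is convex and concave, hence
affine (`exists_eq_log_add_affine`), and `f` is a gamma density up to the signs of the parameters,
which integrability determines (`isGammaDistribution_of_density`).
-/

/-! ### Dispersion statistics -/

/-- A measure of dispersion: a nonnegative, continuous, positively homogeneous and translation
invariant statistic which vanishes only on samples whose entries all agree. -/
structure IsDispersion {n : ℕ} (D : (Fin n → ℝ) → ℝ) : Prop where
  continuous : Continuous D
  map_smul : ∀ c : ℝ, 0 < c → ∀ x, D (c • x) = c * D x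
  map_add_const : ∀ x (t : ℝ), D (fun i => x i + t) = D x
  nonneg : ∀ x, 0 ≤ D x
  eq_of_eq_zero : ∀ x, D x = 0 → ∀ i j, x i = x j

lemma sampleMean_add_const {n : ℕ} (hn : 0 < n) (x : Fin n → ℝ) (t : ℝ) :
    sampleMean (fun i => x i + t) = sampleMean x + t := by
  have : (n : ℝ) ≠ 0 := by positivity
  simp only [sampleMean, Finset.sum_add_distrib, Finset.sum_const, Finset.card_univ,
    Fintype.card_fin, nsmul_eq_mul]
  field_simp

lemma sampleMean_smul {n : ℕ} (x : Fin n → ℝ) (c : ℝ) :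
    sampleMean (c • x) = c * sampleMean x := by
  simp only [sampleMean, Pi.smul_apply, smul_eq_mul, ← Finset.mul_sum, mul_div_assoc]

lemma monotone_orderStat {n : ℕ} (x : Fin n → ℝ) : Monotone (orderStat x) :=
  Tuple.monotone_sort x

lemma orderStat_comp_of_monotone {n : ℕ} (x : Fin n → ℝ) {g : ℝ → ℝ} (hg : Monotone g) :
    orderStat (g ∘ x) = g ∘ orderStat x := by
  have h : Monotone ((g ∘ x) ∘ Tuple.sort x) := hg.comp (monotone_orderStat x)
  exact (Tuple.comp_sort_eq_comp_iff_monotone.2 h).symm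

lemma sum_orderStat {n : ℕ} (x : Fin n → ℝ) : ∑ i, orderStat x i = ∑ i, x i :=
  Equiv.sum_comp (Tuple.sort x) x

/-- By the rearrangement inequality, pairing with a nondecreasing weight is maximized by the
nondecreasing arrangement of the sample. -/
lemma sum_mul_orderStat_eq_sup' {n : ℕ} {a : Fin n → ℝ} (ha : Monotone a) (x : Fin n → ℝ) :
    ∑ i, a i * orderStat x i =
      Finset.univ.sup' Finset.univ_nonempty
        (fun σ : Equiv.Perm (Fin n) => ∑ i, a i * x (σ i)) := by
  apply le_antisymm
  · exact Finset.le_sup' (fun σ : Equiv.Perm (Fin n) => ∑ i, a i * x (σ i))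
      (Finset.mem_univ (Tuple.sort x))
  · refine Finset.sup'_le _ _ fun σ _ => ?_
    have := (ha.monovary (monotone_orderStat x)).sum_mul_comp_perm_le_sum_mul
      (σ := σ.trans (Tuple.sort x).symm)
    simpa [orderStat] using this

lemma continuous_sampleMean {n : ℕ} : Continuous (sampleMean (n := n)) := by
  unfold sampleMean; fun_prop

lemma orderedDeviation_eq {n : ℕ} (a x : Fin n → ℝ) :
    orderedDeviation a x = ∑ i, a i * orderStat x i - (∑ i, a i) * sampleMean x := by
  simp only [orderedDeviation, mul_sub, Finset.sum_sub_distrib, Finset.sum_mul]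

/-- The identity behind Chebyshev's sum inequality. -/
lemma sum_sum_sub_mul_sub {n : ℕ} (a y : Fin n → ℝ) :
    ∑ i, ∑ j, (a i - a j) * (y i - y j) =
      2 * (n * ∑ i, a i * y i - (∑ i, a i) * ∑ i, y i) := by
  have h : ∀ i j, (a i - a j) * (y i - y j) = a i * y i + a j * y j - a i * y j - y i * a j := by
    intros; ring
  simp only [h, Finset.sum_sub_distrib, Finset.sum_add_distrib, Finset.sum_const,
    Finset.card_univ, Fintype.card_fin, ← Finset.mul_sum, ← Finset.sum_mul, nsmul_eq_mul]
  ring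

lemma two_mul_orderedDeviation {n : ℕ} (hn : 0 < n) (a x : Fin n → ℝ) :
    2 * (n * orderedDeviation a x) =
      ∑ i, ∑ j, (a i - a j) * (orderStat x i - orderStat x j) := by
  have : (n : ℝ) ≠ 0 := by positivity
  rw [sum_sum_sub_mul_sub, orderedDeviation_eq, sum_orderStat, sampleMean]
  field_simp

lemma sub_mul_sub_nonneg_of_monotone {n : ℕ} {a y : Fin n → ℝ} (ha : Monotone a)
    (hy : Monotone y) (i j : Fin n) : 0 ≤ (a i - a j) * (y i - y j) := by
  rcases le_total i j with h | h
  · exact mul_nonneg_of_nonpos_of_nonpos (sub_nonpos.2 (ha h)) (sub_nonpos.2 (hy h))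
  · exact mul_nonneg (sub_nonneg.2 (ha h)) (sub_nonneg.2 (hy h))

/-- Nonnegativity, with its case of equality, is Chebyshev's sum inequality for the two
nondecreasing families `a` and `orderStat x`. -/
theorem isDispersion_orderedDeviation {n : ℕ} {a : Fin n → ℝ} (ha : Monotone a)
    (hne : ∃ i j, a i ≠ a j) : IsDispersion (orderedDeviation a) := by
  obtain ⟨p, q, hpq⟩ := hne
  have hn : 0 < n := p.pos
  have hn' : (0 : ℝ) < n := by exact_mod_cast hn
  have hnonneg : ∀ x, ∀ i j, 0 ≤ (a i - a j) * (orderStat x i - orderStat x j) := fun x =>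
    sub_mul_sub_nonneg_of_monotone ha (monotone_orderStat x)
  refine ⟨?_, ?_, ?_, ?_, ?_⟩
  · have : orderedDeviation a = fun x => Finset.univ.sup' Finset.univ_nonempty
        (fun σ : Equiv.Perm (Fin n) => ∑ i, a i * x (σ i)) - (∑ i, a i) * sampleMean x := by
      funext x
      rw [orderedDeviation_eq, sum_mul_orderStat_eq_sup' ha]
    rw [this]
    refine Continuous.sub (Continuous.finset_sup'_apply _ fun σ _ => by fun_prop)
      (continuous_const.mul continuous_sampleMean)
  · intro c hc x
    have h : orderStat (c • x) = c • orderStat x :=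
      orderStat_comp_of_monotone x (g := fun y => c * y)
        (fun _ _ h => mul_le_mul_of_nonneg_left h hc.le)
    simp only [orderedDeviation, sampleMean_smul, h, Pi.smul_apply, smul_eq_mul, Finset.mul_sum]
    exact Finset.sum_congr rfl fun i _ => by ring
  · intro x t
    have h : orderStat (fun i => x i + t) = fun i => orderStat x i + t :=
      orderStat_comp_of_monotone x (g := fun y => y + t) (fun _ _ h => add_le_add_left h t)
    simp only [orderedDeviation, sampleMean_add_const hn, h, add_sub_add_right_eq_sub]
  · intro x
    have h1 := two_mul_orderedDeviation hn a x
    have h2 : 0 ≤ ∑ i, ∑ j, (a i - a j) * (orderStat x i - orderStat x j) :=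
      Finset.sum_nonneg fun i _ => Finset.sum_nonneg fun j _ => hnonneg x i j
    rw [← h1] at h2
    exact (mul_nonneg_iff_of_pos_left hn').1 (by linarith)
  · intro x hx
    have h1 := two_mul_orderedDeviation hn a x
    rw [hx, mul_zero, mul_zero] at h1
    have h2 : ∀ i j, (a i - a j) * (orderStat x i - orderStat x j) = 0 := by
      intro i j
      have := (Finset.sum_eq_zero_iff_of_nonneg
        (fun i _ => Finset.sum_nonneg fun j _ => hnonneg x i j)).1 h1.symm i (Finset.mem_univ i)
      exact (Finset.sum_eq_zero_iff_of_nonneg (fun j _ => hnonneg x i j)).1 this j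
        (Finset.mem_univ j)
    let z : Fin n := ⟨0, hn⟩
    let l : Fin n := ⟨n - 1, Nat.sub_lt hn Nat.one_pos⟩
    have hz : ∀ i, z ≤ i := fun i => Fin.mk_le_of_le_val (Nat.zero_le _)
    have hl : ∀ i, i ≤ l := fun i => Fin.le_def.2 (Nat.le_sub_one_of_lt i.2)
    have hzl : a l - a z ≠ 0 := by
      intro h
      apply hpq
      have := ha (hz p); have := ha (hl p); have := ha (hz q); have := ha (hl q)
      linarith
    have h3 : orderStat x l - orderStat x z = 0 := (mul_eq_zero.1 (h2 l z)).resolve_left hzl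
    have h4 : ∀ i, x i = orderStat x z := by
      intro i
      have e : orderStat x ((Tuple.sort x).symm i) = x i := by simp [orderStat]
      rw [← e]
      have := monotone_orderStat x (hz ((Tuple.sort x).symm i))
      have := monotone_orderStat x (hl ((Tuple.sort x).symm i))
      linarith
    intro i j
    rw [h4 i, h4 j]

/-- The range is the ordered deviation with weight `-1` on the minimum, `1` on the maximum. -/
lemma sampleRange_eq_orderedDeviation {n : ℕ} (hn : 0 < n) (x : Fin n → ℝ) :
    sampleRange hn x = orderedDeviation
      (fun i => (if i = ⟨n - 1, Nat.sub_lt hn Nat.one_pos⟩ then 1 else 0) -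
        (if i = ⟨0, hn⟩ then 1 else 0)) x := by
  simp [orderedDeviation_eq, sub_mul, sampleRange, Finset.sum_sub_distrib]

theorem isDispersion_sampleRange {n : ℕ} (hn : 0 < n) (hn2 : 2 ≤ n) :
    IsDispersion (sampleRange hn) := by
  have h := funext (sampleRange_eq_orderedDeviation hn)
  rw [h]
  apply isDispersion_orderedDeviation
  · intro i j hij
    have hij : i.val ≤ j.val := hij
    have := i.2
    have := j.2
    simp only [Fin.ext_iff]
    split_ifs <;> first | omega | norm_num
  · refine ⟨⟨n - 1, Nat.sub_lt hn Nat.one_pos⟩, ⟨0, hn⟩, ?_⟩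
    have : ¬ (n - 1 = 0) := by omega
    have : ¬ (0 = n - 1) := by omega
    simp only [Fin.ext_iff, *, if_true, if_false]
    norm_num

theorem isDispersion_giniMeanDifference {n : ℕ} (hn : 2 ≤ n) :
    IsDispersion (giniMeanDifference (n := n)) := by
  have h2 : (2 : ℝ) ≤ n := by exact_mod_cast hn
  have hpos : 0 < 1 / ((n : ℝ) * ((n : ℝ) - 1)) := by
    have : 0 < (n : ℝ) - 1 := by linarith
    positivity
  refine ⟨by unfold giniMeanDifference; fun_prop, ?_, ?_, ?_, ?_⟩
  · intro c hc x
    simp only [giniMeanDifference, Pi.smul_apply, smul_eq_mul, ← mul_sub, abs_mul, abs_of_pos hc,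
      ← Finset.mul_sum]
    ring
  · intro x t
    simp only [giniMeanDifference, add_sub_add_right_eq_sub]
  · intro x
    exact mul_nonneg hpos.le
      (Finset.sum_nonneg fun i _ => Finset.sum_nonneg fun j _ => abs_nonneg _)
  · intro x hx i j
    have h := (mul_eq_zero.1 hx).resolve_left hpos.ne'
    have := (Finset.sum_eq_zero_iff_of_nonneg
      (fun i _ => Finset.sum_nonneg fun j _ => abs_nonneg _)).1 h i (Finset.mem_univ i)
    have := (Finset.sum_eq_zero_iff_of_nonneg (fun j _ => abs_nonneg _)).1 this j
      (Finset.mem_univ j)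
    exact sub_eq_zero.1 (abs_eq_zero.1 this)

/-! ### The decomposition of a sample into its mean and its centered part -/

lemma lintegral_pi_prod {n : ℕ} (f : Fin n → ℝ → ENNReal) (hf : ∀ i, Measurable (f i)) :
    ∫⁻ x : Fin n → ℝ, ∏ i, f i (x i) = ∏ i, ∫⁻ t, f i t := by
  induction n with
  | zero => simp [volume_pi]
  | succ n ih =>
    have h := (volume_preserving_piFinSuccAbove (fun _ : Fin (n + 1) => ℝ) 0).symm
    rw [← h.lintegral_comp_emb (MeasurableEquiv.measurableEmbedding _), Fin.prod_univ_succ,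
      ← ih (fun i => f i.succ) (fun i => hf _), Measure.volume_eq_prod]
    have hm : Measurable fun x : Fin n → ℝ => ∏ i, f i.succ (x i) :=
      Finset.measurable_prod _ fun i _ => (hf _).comp (measurable_pi_apply i)
    rw [← lintegral_prod_mul (hf 0).aemeasurable hm.aemeasurable]
    refine lintegral_congr fun p => ?_
    rw [Fin.prod_univ_succ]
    rfl

/-- The law of an independent sample with density `ρ`. -/
lemma pi_withDensity {n : ℕ} {ρ : ℝ → ENNReal} (hρ : Measurable ρ)
    [IsProbabilityMeasure (volume.withDensity ρ)] :
    Measure.pi (fun _ : Fin n => volume.withDensity ρ) =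
      volume.withDensity (fun x : Fin n → ℝ => ∏ i, ρ (x i)) := by
  refine Measure.pi_eq fun s hs => ?_
  have hS : MeasurableSet (univ.pi s) := MeasurableSet.univ_pi hs
  rw [withDensity_apply _ hS, ← lintegral_indicator hS]
  simp only [withDensity_apply _ (hs _), ← lintegral_indicator (hs _)]
  rw [← lintegral_pi_prod _ fun i => hρ.indicator (hs i)]
  refine lintegral_congr fun x => ?_
  by_cases hx : x ∈ univ.pi s
  · rw [indicator_of_mem hx]
    exact Finset.prod_congr rfl fun i _ => (indicator_of_mem (hx i (mem_univ i)) _).symm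
  · rw [indicator_of_notMem hx]
    simp only [mem_univ_pi, not_forall] at hx
    obtain ⟨i, hi⟩ := hx
    exact (Finset.prod_eq_zero (Finset.mem_univ i) (indicator_of_notMem hi _)).symm

/-- The hyperplane of vectors with zero sum. -/
def centered (n : ℕ) : Submodule ℝ (Fin n → ℝ) where
  carrier := {v | ∑ i, v i = 0}
  add_mem' {v w} hv hw := by
    simp only [mem_ofPred_eq] at *
    simp [Finset.sum_add_distrib, hv, hw]
  zero_mem' := by simp
  smul_mem' c v hv := by
    simp only [mem_ofPred_eq] at *
    simp [← Finset.mul_sum, hv]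

lemma sum_centered {n : ℕ} (v : centered n) : ∑ i, v.1 i = 0 := v.2

lemma sampleMean_centered {n : ℕ} (v : centered n) : sampleMean v.1 = 0 := by
  simp [sampleMean, sum_centered]

lemma continuous_centered_apply {n : ℕ} (i : Fin n) : Continuous fun v : centered n => v.1 i :=
  (continuous_apply i).comp continuous_subtype_val

/-- Haar measure on the hyperplane of centered vectors. -/
noncomputable def centeredHaar (n : ℕ) : Measure (centered n) := Measure.addHaar

noncomputable instance (n : ℕ) : (centeredHaar n).IsAddHaarMeasure := by
  unfold centeredHaar; infer_instance

/-- The decomposition of a sample into its mean and its centered part. -/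
noncomputable def meanEquiv {n : ℕ} (hn : 0 < n) : (ℝ × centered n) ≃L[ℝ] (Fin n → ℝ) :=
  LinearEquiv.toContinuousLinearEquiv
    { toFun := fun p i => p.1 + p.2.1 i
      map_add' := fun p q => by funext i; simp; ring
      map_smul' := fun c p => by funext i; simp; ring
      invFun := fun x => (sampleMean x, ⟨fun i => x i - sampleMean x, by
        have : (n : ℝ) ≠ 0 := by positivity
        change ∑ i, (x i - sampleMean x) = 0
        simp only [Finset.sum_sub_distrib, sampleMean, Finset.sum_const, Finset.card_univ,
          Fintype.card_fin, nsmul_eq_mul]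
        field_simp
        ring⟩)
      left_inv := fun p => by
        have h : sampleMean (fun i => p.1 + p.2.1 i) = p.1 := by
          simp only [add_comm p.1]
          rw [sampleMean_add_const hn, sampleMean_centered, zero_add]
        refine Prod.ext h (Subtype.ext (funext fun i => ?_))
        simp [h]
      right_inv := fun x => by funext i; simp }

/-- Integration in the coordinates given by the mean and the centered part. The Jacobian is an
unspecified constant. -/
lemma exists_lintegral_eq_mean_centered {n : ℕ} (hn : 0 < n) :
    ∃ c : ENNReal, c ≠ 0 ∧ c ≠ ⊤ ∧ ∀ Φ : (Fin n → ℝ) → ENNReal, Measurable Φ →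
      ∫⁻ x, Φ x = c * ∫⁻ t : ℝ, ∫⁻ v, Φ (fun i => t + v.1 i) ∂centeredHaar n := by
  let ν : Measure (Fin n → ℝ) := (volume.prod (centeredHaar n)).map (meanEquiv hn)
  have : ν.IsAddHaarMeasure := (meanEquiv hn).isAddHaarMeasure_map _
  obtain ⟨c, hc0, hct, hc⟩ : ∃ c : ENNReal, c ≠ 0 ∧ c ≠ ⊤ ∧
      (volume : Measure (Fin n → ℝ)) = c • ν := by
    refine ⟨_, ?_, ENNReal.coe_ne_top, Measure.isAddLeftInvariant_eq_smul volume ν⟩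
    exact ENNReal.coe_ne_zero.2 (Measure.addHaarScalarFactor_pos_of_isAddHaarMeasure _ _).ne'
  refine ⟨c, hc0, hct, fun Φ hΦ => ?_⟩
  have hm : Measurable (meanEquiv hn) := (meanEquiv hn).continuous.measurable
  have hΦm : Measurable fun p => Φ (meanEquiv hn p) := hΦ.comp hm
  rw [hc, lintegral_smul_measure, lintegral_map hΦ hm, lintegral_prod _ hΦm.aemeasurable,
    smul_eq_mul]
  rfl

/-- Integration over samples of positive mean `t`, written as `t (1 + v)` with `v` centered. -/
lemma exists_lintegral_eq_polar {n : ℕ} (hn : 0 < n) :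
    ∃ c : ENNReal, c ≠ 0 ∧ c ≠ ⊤ ∧ ∃ d : ℕ, ∀ Φ : (Fin n → ℝ) → ENNReal, Measurable Φ →
      (∀ x, sampleMean x ≤ 0 → Φ x = 0) →
      ∫⁻ x, Φ x = c * ∫⁻ t in Ioi (0 : ℝ), ENNReal.ofReal (t ^ d) *
        ∫⁻ v, Φ (fun i => t * (1 + v.1 i)) ∂centeredHaar n := by
  obtain ⟨c, hc0, hct, hc⟩ := exists_lintegral_eq_mean_centered hn
  refine ⟨c, hc0, hct, Module.finrank ℝ (centered n), fun Φ hΦ hΦ0 => ?_⟩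
  rw [hc Φ hΦ, ← lintegral_indicator measurableSet_Ioi]
  congr 1
  refine lintegral_congr fun t => ?_
  have hmeas : Measurable fun v : centered n => Φ (fun i => t + v.1 i) :=
    hΦ.comp (measurable_pi_lambda _ fun i =>
      (continuous_const.add (continuous_centered_apply i)).measurable)
  by_cases ht : 0 < t
  · rw [indicator_of_mem (mem_Ioi.2 ht)]
    have hmap := Measure.map_addHaar_smul (centeredHaar n) ht.ne'
    have hpow : 0 < t ^ Module.finrank ℝ (centered n) := by positivity
    have h := lintegral_map (μ := centeredHaar n) hmeas (measurable_const_smul t)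
    rw [hmap, lintegral_smul_measure, abs_of_pos (inv_pos.2 hpow)] at h
    have h' : ∀ v : centered n, (fun i => t * (1 + v.1 i)) = fun i => t + (t • v).1 i := by
      intro v; funext i; simp [mul_add]
    simp only [h']
    rw [← h, smul_eq_mul, ← mul_assoc, ← ENNReal.ofReal_mul hpow.le, mul_inv_cancel₀ hpow.ne',
      ENNReal.ofReal_one, one_mul]
  · rw [indicator_of_notMem (by simpa using ht)]
    rw [lintegral_eq_zero_iff hmeas]
    refine Filter.Eventually.of_forall fun v => hΦ0 _ ?_
    simp only [add_comm t]
    rw [sampleMean_add_const hn, sampleMean_centered, zero_add]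
    exact not_lt.1 ht

/-! ### Convexity up to a multiple of the logarithm -/

/-- A continuous function that is not convex has, after subtraction of a suitable linear function,
an interior local maximum. -/
lemma exists_isLocalMax_of_not_convexOn {k : ℝ → ℝ} (hk : ContinuousOn k (Ioi 0))
    (h : ¬ ConvexOn ℝ (Ioi 0) k) :
    ∃ β y₀ : ℝ, 0 < y₀ ∧ IsLocalMax (fun y => k y - β * y) y₀ := by
  by_contra! hno
  refine h (convexOn_of_slope_mono_adjacent (convex_Ioi 0) fun {x y z} hx _ hxy hyz => ?_)
  by_contra! hlt
  obtain ⟨β, h1, h2⟩ := exists_between hlt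
  have hx : 0 < x := hx
  rw [div_lt_iff₀ (sub_pos.2 hyz)] at h1
  rw [lt_div_iff₀ (sub_pos.2 hxy)] at h2
  have hsub : Icc x z ⊆ Ioi 0 := fun w hw => hx.trans_le hw.1
  obtain ⟨w, hw, hmax⟩ := isCompact_Icc.exists_isMaxOn (nonempty_Icc.2 (hxy.trans hyz).le)
    ((hk.mono hsub).sub
      (continuous_const.mul continuous_id : Continuous fun y => β * y).continuousOn)
  have hwy : k y - β * y ≤ k w - β * w := hmax ⟨hxy.le, hyz.le⟩
  have hwx : w ≠ x := by rintro rfl; linarith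
  have hwz : w ≠ z := by rintro rfl; linarith
  exact hno β w (hsub hw) (hmax.isLocalMax
    (Icc_mem_nhds (lt_of_le_of_ne hw.1 hwx.symm) (lt_of_le_of_ne hw.2 hwz)))

lemma exists_isLocalMin_of_not_concaveOn {k : ℝ → ℝ} (hk : ContinuousOn k (Ioi 0))
    (h : ¬ ConcaveOn ℝ (Ioi 0) k) :
    ∃ β y₀ : ℝ, 0 < y₀ ∧ IsLocalMin (fun y => k y - β * y) y₀ := by
  obtain ⟨β, y₀, hy, hmax⟩ := exists_isLocalMax_of_not_convexOn (k := -k) hk.neg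
    (by rwa [neg_convexOn_iff])
  refine ⟨-β, y₀, hy, ?_⟩
  have e : (fun y => k y - -β * y) = fun y => -((-k) y - β * y) := by
    funext y
    simp only [Pi.neg_apply]
    ring
  rw [e]
  exact hmax.neg

lemma exists_eq_affine_of_convexOn_concaveOn {k : ℝ → ℝ} (h₁ : ConvexOn ℝ (Ioi 0) k)
    (h₂ : ConcaveOn ℝ (Ioi 0) k) : ∃ β γ : ℝ, ∀ x, 0 < x → k x = β * x + γ := by
  have key : ∀ x y z : ℝ, 0 < x → x < y → y < z →
      (z - y) * (k y - k x) = (y - x) * (k z - k y) := by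
    intro x y z hx hxy hyz
    have a := h₁.slope_mono_adjacent hx (hx.trans (hxy.trans hyz)) hxy hyz
    have b := h₂.slope_anti_adjacent hx (hx.trans (hxy.trans hyz)) hxy hyz
    have e := le_antisymm a b
    rw [div_eq_div_iff (sub_pos.2 hxy).ne' (sub_pos.2 hyz).ne'] at e
    linarith
  refine ⟨k 2 - k 1, 2 * k 1 - k 2, fun x hx => ?_⟩
  rcases lt_trichotomy x 1 with h | rfl | h
  · linarith [key x 1 2 hx h one_lt_two]
  · ring
  rcases lt_trichotomy x 2 with h' | rfl | h'
  · linarith [key 1 x 2 one_pos h h']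
  · ring
  · linarith [key 1 2 x one_pos one_lt_two h']

/-- If `k + l log` is convex or `k + l' log` is concave whenever `l < l'`, then at a
critical value of `l` the function `k + l log` is both, hence affine. -/
lemma exists_eq_log_add_affine {k : ℝ → ℝ}
    (h : ∀ l l' : ℝ, l < l' → ConvexOn ℝ (Ioi 0) (fun y => k y + l * Real.log y) ∨
      ConcaveOn ℝ (Ioi 0) (fun y => k y + l' * Real.log y)) :
    ∃ l β γ : ℝ, ∀ x, 0 < x → k x = -l * Real.log x + β * x + γ := by
  set V : Set ℝ := {l | ConvexOn ℝ (Ioi 0) (fun y => k y + l * Real.log y)} with hV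
  have hlog : 0 < Real.log 2 - Real.log 3 / 2 := by
    have h4 : Real.log 4 = 2 * Real.log 2 := by
      rw [show (4 : ℝ) = 2 ^ 2 by norm_num, Real.log_pow]; norm_num
    have := Real.log_lt_log (by norm_num : (0 : ℝ) < 3) (by norm_num : (3 : ℝ) < 4)
    linarith
  set b := Real.log 2 - Real.log 3 / 2 with hb
  set e := k 1 / 2 + k 3 / 2 - k 2 with he
  -- Both exclusions test midpoint convexity at `1, 2, 3`, where `log` is strictly concave.
  have hVbd : ∀ l, l ∈ V → l ≤ e / b := by
    intro l hl
    have := (And.right hl) (mem_Ioi.2 one_pos : (1 : ℝ) ∈ Ioi 0)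
      (mem_Ioi.2 three_pos : (3 : ℝ) ∈ Ioi 0)
      (by norm_num : (0 : ℝ) ≤ 1 / 2) (by norm_num : (0 : ℝ) ≤ 1 / 2) (by norm_num)
    norm_num [smul_eq_mul] at this
    rw [le_div_iff₀ hlog, hb, he]
    linarith
  have hWbd : ∀ l, ConcaveOn ℝ (Ioi 0) (fun y => k y + l * Real.log y) → e / b ≤ l := by
    intro l hl
    have := (And.right hl) (mem_Ioi.2 one_pos : (1 : ℝ) ∈ Ioi 0)
      (mem_Ioi.2 three_pos : (3 : ℝ) ∈ Ioi 0)
      (by norm_num : (0 : ℝ) ≤ 1 / 2) (by norm_num : (0 : ℝ) ≤ 1 / 2) (by norm_num)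
    norm_num [smul_eq_mul] at this
    rw [div_le_iff₀ hlog, hb, he]
    linarith
  have hdown : ∀ l l', l ∈ V → l' ≤ l → l' ∈ V := by
    intro l l' hl hll
    have := ConvexOn.add (show ConvexOn ℝ (Ioi 0) (fun y => k y + l * Real.log y) from hl)
      (strictConcaveOn_log_Ioi.concaveOn.neg.smul (sub_nonneg.2 hll))
    change ConvexOn ℝ (Ioi 0) (fun y => k y + l' * Real.log y)
    refine this.congr fun y _ => ?_
    simp [smul_eq_mul]
    ring
  have hbdd : BddAbove V := ⟨e / b, hVbd⟩
  have hne : V.Nonempty := by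
    refine ⟨e / b - 2, (h (e / b - 2) (e / b - 1) (by linarith)).resolve_right fun hc => ?_⟩
    linarith [hWbd _ hc]
  set L := sSup V
  -- Both properties at `L` are limits, from the left and from the right.
  have hconv : ConvexOn ℝ (Ioi 0) (fun y => k y + L * Real.log y) := by
    refine ⟨convex_Ioi 0, fun x hx y hy a c ha hc hac => ?_⟩
    have hcont : ∀ w, Filter.Tendsto (fun l : ℝ => k w + l * Real.log w) (nhdsWithin L (Iio L))
        (nhds (k w + L * Real.log w)) := fun w =>
      ((continuous_const.add (continuous_id.mul continuous_const)).tendsto L).mono_left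
        nhdsWithin_le_nhds
    refine le_of_tendsto_of_tendsto (hcont _)
      (((hcont x).const_smul a).add ((hcont y).const_smul c)) ?_
    filter_upwards [self_mem_nhdsWithin] with l hl
    obtain ⟨l', hl', hlt⟩ := exists_lt_of_lt_csSup hne hl
    exact And.right (hdown _ _ hl' hlt.le) hx hy ha hc hac
  have hconc : ConcaveOn ℝ (Ioi 0) (fun y => k y + L * Real.log y) := by
    refine ⟨convex_Ioi 0, fun x hx y hy a c ha hc hac => ?_⟩
    have hcont : ∀ w, Filter.Tendsto (fun l : ℝ => k w + l * Real.log w) (nhdsWithin L (Ioi L))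
        (nhds (k w + L * Real.log w)) := fun w =>
      ((continuous_const.add (continuous_id.mul continuous_const)).tendsto L).mono_left
        nhdsWithin_le_nhds
    refine le_of_tendsto_of_tendsto
      (((hcont x).const_smul a).add ((hcont y).const_smul c)) (hcont _) ?_
    filter_upwards [self_mem_nhdsWithin] with l' hl'
    obtain ⟨l, hl, hll⟩ := exists_between (mem_Ioi.1 hl')
    exact ((h l l' hll).resolve_left fun hv => hl.not_ge (le_csSup hbdd hv)).2 hx hy ha hc hac
  obtain ⟨β, γ, hk⟩ := exists_eq_affine_of_convexOn_concaveOn hconv hconc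
  exact ⟨L, β, γ, fun x hx => by linarith [hk x hx]⟩

/-! ### Comparison with gamma densities -/

/-- The centered vectors on which the statistic `D` is at most `ε`. -/
def centeredSublevel {n : ℕ} (D : (Fin n → ℝ) → ℝ) (ε : ℝ) : Set (centered n) :=
  {v | D v.1 ≤ ε}

namespace IsDispersion

variable {n : ℕ} {D : (Fin n → ℝ) → ℝ}

lemma continuous_centered (hD : IsDispersion D) : Continuous fun v : centered n => D v.1 :=
  hD.continuous.comp continuous_subtype_val

lemma map_zero (hD : IsDispersion D) : D 0 = 0 := by
  have := hD.map_smul 2 two_pos 0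
  rw [smul_zero] at this
  linarith

lemma pos_of_ne_zero (hD : IsDispersion D) {v : centered n} (hv : v ≠ 0) : 0 < D v.1 := by
  refine lt_of_le_of_ne (hD.nonneg _) fun h => hv (Subtype.ext (funext fun i => ?_))
  have h1 := hD.eq_of_eq_zero _ h.symm
  have h2 : ∑ j, v.1 j = n * v.1 i := by
    rw [Finset.sum_congr rfl fun j _ => h1 j i]; simp
  rw [sum_centered] at h2
  have hn : (n : ℝ) ≠ 0 := by have := i.pos; positivity
  simpa [hn] using h2.symm

/-- On centered vectors a dispersion dominates the norm, by compactness of the unit sphere. -/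
lemma exists_mul_norm_le (hD : IsDispersion D) :
    ∃ κ : ℝ, 0 < κ ∧ ∀ v : centered n, κ * ‖v‖ ≤ D v.1 := by
  rcases (Metric.sphere (0 : centered n) 1).eq_empty_or_nonempty with h | h
  · refine ⟨1, one_pos, fun v => ?_⟩
    by_cases hv : v = 0
    · simp [hv, hD.map_zero]
    · exact absurd (show ‖v‖⁻¹ • v ∈ Metric.sphere (0 : centered n) 1 by
        simp [norm_smul, hv]) (by simp [h])
  · obtain ⟨w, hw, hmin⟩ := (isCompact_sphere (0 : centered n) 1).exists_isMinOn h
      hD.continuous_centered.continuousOn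
    have hw0 : w ≠ 0 := by
      rintro rfl; simp at hw
    refine ⟨D w.1, hD.pos_of_ne_zero hw0, fun v => ?_⟩
    by_cases hv : v = 0
    · simp [hv, hD.map_zero]
    have hv' : 0 < ‖v‖ := norm_pos_iff.2 hv
    have h1 : D w.1 ≤ D (‖v‖⁻¹ • v : centered n).1 := hmin (by simp [norm_smul, hv])
    have h2 : D (‖v‖⁻¹ • v : centered n).1 = ‖v‖⁻¹ * D v.1 :=
      hD.map_smul _ (inv_pos.2 hv') _
    rw [h2, inv_mul_eq_div, le_div_iff₀ hv'] at h1
    exact h1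

lemma isClosed_centeredSublevel (hD : IsDispersion D) (ε : ℝ) :
    IsClosed (centeredSublevel D ε) :=
  isClosed_le hD.continuous_centered continuous_const

lemma isCompact_centeredSublevel (hD : IsDispersion D) (ε : ℝ) :
    IsCompact (centeredSublevel D ε) := by
  obtain ⟨κ, hκ, h⟩ := hD.exists_mul_norm_le
  refine (isCompact_closedBall (0 : centered n) (ε / κ)).of_isClosed_subset
    (hD.isClosed_centeredSublevel ε) fun v hv => ?_
  rw [mem_closedBall_zero_iff, le_div_iff₀ hκ, mul_comm]
  exact (h v).trans hv

/-- The sublevel sets shrink to the origin. -/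
lemma eventually_norm_lt (hD : IsDispersion D) {δ : ℝ} (hδ : 0 < δ) :
    ∀ᶠ ε in nhdsWithin (0 : ℝ) (Ioi 0), ∀ v ∈ centeredSublevel D ε, ‖v‖ < δ := by
  obtain ⟨κ, hκ, h⟩ := hD.exists_mul_norm_le
  filter_upwards [nhdsWithin_le_nhds (Iio_mem_nhds (mul_pos hκ hδ))] with ε hε v hv
  have h1 : κ * ‖v‖ < κ * δ := ((h v).trans hv).trans_lt hε
  exact lt_of_mul_lt_mul_left h1 hκ.le

lemma measure_centeredSublevel_pos (hD : IsDispersion D) {ε : ℝ} (hε : 0 < ε) :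
    0 < centeredHaar n (centeredSublevel D ε) := by
  have ho : IsOpen {v : centered n | D v.1 < ε} :=
    isOpen_lt hD.continuous_centered continuous_const
  refine (ho.measure_pos _ ⟨0, ?_⟩).trans_le (measure_mono fun v (hv : D v.1 < ε) => hv.le)
  change D 0 < ε
  rwa [hD.map_zero]

lemma measure_centeredSublevel_lt_top (hD : IsDispersion D) (ε : ℝ) :
    centeredHaar n (centeredSublevel D ε) < ⊤ :=
  (hD.isCompact_centeredSublevel ε).measure_lt_top

end IsDispersion

lemma abs_centered_apply_le {n : ℕ} (v : centered n) (i : Fin n) : |v.1 i| ≤ ‖v‖ := by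
  simpa using norm_le_pi_norm v.1 i

lemma one_add_centered_pos {n : ℕ} {v : centered n} (hv : ‖v‖ < 1) (i : Fin n) :
    0 < 1 + v.1 i := by
  have := (abs_le.1 (abs_centered_apply_le v i)).1
  linarith

lemma nontrivial_centered {n : ℕ} (hn : 2 ≤ n) : Nontrivial (centered n) := by
  let i : Fin n := ⟨0, by omega⟩
  let j : Fin n := ⟨1, by omega⟩
  have hij : i ≠ j := by simp [i, j, Fin.ext_iff]
  refine ⟨⟨⟨fun l => (if l = i then 1 else 0) - (if l = j then 1 else 0), ?_⟩, 0, fun h => ?_⟩⟩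
  · change ∑ l, _ = (0 : ℝ)
    simp [Finset.sum_sub_distrib]
  · have := congrFun (congrArg Subtype.val h) i
    simp [hij] at this

/-- The product `∏ (1 + v i)` over a small nonzero centered vector is strictly below `1`. -/
lemma prod_one_add_centered_lt_one {n : ℕ} {v : centered n} (hv : ‖v‖ < 1) (h0 : v ≠ 0) :
    ∏ i, (1 + v.1 i) < 1 := by
  obtain ⟨i, hi⟩ : ∃ i, v.1 i ≠ 0 := by
    by_contra! h
    exact h0 (Subtype.ext (funext h))
  calc ∏ i, (1 + v.1 i) < ∏ i, Real.exp (v.1 i) := by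
        refine Finset.prod_lt_prod (fun i _ => one_add_centered_pos hv i)
          (fun i _ => ?_) ⟨i, Finset.mem_univ i, ?_⟩
        · rw [add_comm]; exact Real.add_one_le_exp _
        · rw [add_comm]; exact Real.add_one_lt_exp hi
    _ = 1 := by rw [← Real.exp_sum, sum_centered, Real.exp_zero]

lemma continuousOn_prod_mul_one_add {n : ℕ} {D : (Fin n → ℝ) → ℝ} {f : ℝ → ℝ}
    (hf : ContinuousOn f (Ioi 0)) {ε : ℝ} (hε : ∀ v ∈ centeredSublevel D ε, ‖v‖ < 1) :
    ContinuousOn (fun p : ℝ × centered n => ∏ i, f (p.1 * (1 + p.2.1 i)))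
      (Ioi 0 ×ˢ centeredSublevel D ε) := by
  refine continuousOn_finsetProd _ fun i _ => hf.comp (Continuous.continuousOn ?_) ?_
  · exact continuous_fst.mul
      (continuous_const.add ((continuous_centered_apply i).comp continuous_snd))
  · rintro ⟨t, v⟩ ⟨ht, hv⟩
    exact mul_pos ht (one_add_centered_pos (hε v hv) i)

lemma continuousOn_prod_mul_one_add_right {n : ℕ} {D : (Fin n → ℝ) → ℝ} {f : ℝ → ℝ}
    (hf : ContinuousOn f (Ioi 0)) {ε : ℝ} (hε : ∀ v ∈ centeredSublevel D ε, ‖v‖ < 1)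
    {t : ℝ} (ht : 0 < t) :
    ContinuousOn (fun v : centered n => ∏ i, f (t * (1 + v.1 i))) (centeredSublevel D ε) :=
  (continuousOn_prod_mul_one_add hf hε).comp
    (Continuous.continuousOn (continuous_const.prodMk continuous_id) :
      ContinuousOn (fun v : centered n => (t, v)) _)
    fun _ hv => ⟨ht, hv⟩

/-- The integral of `∏ f (t (1 + v i)) / f t ^ n` over a sublevel set for `f x = x ^ (-l)`, or
equally for `f x = x ^ (-l) * exp (β x)`; it does not depend on `t`. -/
noncomputable def powerAverage {n : ℕ} (D : (Fin n → ℝ) → ℝ) (l ε : ℝ) : ℝ :=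
  ∫ v in centeredSublevel D ε, (∏ i, (1 + v.1 i)) ^ (-l) ∂centeredHaar n

namespace IsDispersion

variable {n : ℕ} {D : (Fin n → ℝ) → ℝ}

lemma integrableOn_prod_rpow (hD : IsDispersion D) {ε : ℝ}
    (hε : ∀ v ∈ centeredSublevel D ε, ‖v‖ < 1) (l : ℝ) :
    IntegrableOn (fun v : centered n => (∏ i, (1 + v.1 i)) ^ (-l)) (centeredSublevel D ε)
      (centeredHaar n) := by
  refine ContinuousOn.integrableOn_compact (hD.isCompact_centeredSublevel ε) ?_
  refine ContinuousOn.rpow_const (Continuous.continuousOn ?_) fun v hv => Or.inl ?_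
  · exact continuous_finsetProd _ fun i _ => continuous_const.add (continuous_centered_apply i)
  · exact (Finset.prod_pos fun i _ => one_add_centered_pos (hε v hv) i).ne'

lemma integrableOn_prod_comp (hD : IsDispersion D) {f : ℝ → ℝ}
    (hf : ContinuousOn f (Ioi 0)) {ε : ℝ} (hε : ∀ v ∈ centeredSublevel D ε, ‖v‖ < 1)
    {t : ℝ} (ht : 0 < t) :
    IntegrableOn (fun v : centered n => ∏ i, f (t * (1 + v.1 i))) (centeredSublevel D ε)
      (centeredHaar n) :=
  (continuousOn_prod_mul_one_add_right hf hε ht).integrableOn_compact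
    (hD.isCompact_centeredSublevel ε)

lemma powerAverage_lt (hD : IsDispersion D) (hn : 2 ≤ n) {ε : ℝ} (hε0 : 0 < ε)
    (hε : ∀ v ∈ centeredSublevel D ε, ‖v‖ < 1) {l l' : ℝ} (hl : l < l') :
    powerAverage D l ε < powerAverage D l' ε := by
  have := nontrivial_centered hn
  have hi := hD.integrableOn_prod_rpow hε l
  have hi' := hD.integrableOn_prod_rpow hε l'
  have hKm := (hD.isClosed_centeredSublevel ε).measurableSet
  have hlt : ∀ v ∈ centeredSublevel D ε, v ≠ 0 →
      (∏ i, (1 + v.1 i)) ^ (-l) < (∏ i, (1 + v.1 i)) ^ (-l') := fun v hv h0 =>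
    Real.rpow_lt_rpow_of_exponent_gt
      (Finset.prod_pos fun i _ => one_add_centered_pos (hε v hv) i)
      (prod_one_add_centered_lt_one (hε v hv) h0) (neg_lt_neg hl)
  rw [powerAverage, powerAverage, ← sub_pos, ← integral_sub hi' hi,
    setIntegral_pos_iff_support_of_nonneg_ae]
  · refine (hD.measure_centeredSublevel_pos hε0).trans_le ?_
    rw [← measure_sdiff_null (measure_singleton (0 : centered n))]
    refine measure_mono fun v hv => ⟨?_, hv.1⟩
    exact (sub_pos.2 (hlt v hv.1 hv.2)).ne'
  · filter_upwards [ae_restrict_mem hKm] with v hv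
    by_cases h0 : v = 0
    · simp [h0]
    · exact (sub_pos.2 (hlt v hv h0)).le
  · exact hi'.sub hi

end IsDispersion

/-- The increment of `f` from `y` to `y * (1 + s)`, compared with that of
`x ^ (-l) * exp (β x)`: the last factor is at most `1` at a local maximum of
`log f + l log - β x`, and at least `1` at a local minimum. -/
lemma eq_mul_rpow_mul_exp {f : ℝ → ℝ} (hpos : ∀ x, 0 < x → 0 < f x) (l β : ℝ) {y s : ℝ}
    (hy : 0 < y) (hs : 0 < 1 + s) :
    f (y * (1 + s)) = f y * (1 + s) ^ (-l) * Real.exp (β * y * s) *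
      Real.exp ((Real.log (f (y * (1 + s))) + l * Real.log (y * (1 + s)) - β * (y * (1 + s))) -
        (Real.log (f y) + l * Real.log y - β * y)) := by
  have h1 : 0 < y * (1 + s) := mul_pos hy hs
  conv_rhs => rw [← Real.exp_log (hpos y hy), Real.rpow_def_of_pos hs, ← Real.exp_add,
    ← Real.exp_add, ← Real.exp_add]
  conv_lhs => rw [← Real.exp_log (hpos _ h1)]
  rw [Real.exp_log (hpos y hy), Real.log_mul hy.ne' hs.ne']
  congr 1
  ring

/-- The linear exponents cancel in the product, since `v` is centered. -/
lemma prod_gamma_form {n : ℕ} (f : ℝ → ℝ) (l β y : ℝ) {v : centered n} (hv : ‖v‖ < 1) :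
    ∏ i, (f y * (1 + v.1 i) ^ (-l) * Real.exp (β * y * v.1 i)) =
      f y ^ n * (∏ i, (1 + v.1 i)) ^ (-l) := by
  rw [Finset.prod_mul_distrib, Finset.prod_mul_distrib, ← Real.exp_sum, ← Finset.mul_sum,
    sum_centered, mul_zero, Real.exp_zero, mul_one, Finset.prod_const,
    Real.finsetProd_rpow _ _ fun i _ => (one_add_centered_pos hv i).le]
  simp

section Comparison

variable {n : ℕ} {D : (Fin n → ℝ) → ℝ} {f : ℝ → ℝ} {M : ℝ → ℝ} {l β y : ℝ}

/-- If `x ^ (-l) * exp (β x)` touches `f` from above at `y`, up to a constant factor, the constants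
in the identity for `f` are at most those of the power `x ^ (-l)`. -/
lemma IsDispersion.eventually_le_powerAverage (hD : IsDispersion D)
    (hf : ContinuousOn f (Ioi 0)) (hpos : ∀ x, 0 < x → 0 < f x)
    (hM : ∀ᶠ ε in nhdsWithin (0 : ℝ) (Ioi 0), ∀ t, 0 < t →
      ∫ v in centeredSublevel D ε, ∏ i, f (t * (1 + v.1 i)) ∂centeredHaar n = f t ^ n * M ε)
    (hy : 0 < y)
    (hmax : IsLocalMax (fun y => Real.log (f y) + l * Real.log y - β * y) y) :
    ∀ᶠ ε in nhdsWithin (0 : ℝ) (Ioi 0), M ε ≤ powerAverage D l ε := by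
  obtain ⟨δ, hδ, hball⟩ := Metric.eventually_nhds_iff.1 hmax
  filter_upwards [hM, hD.eventually_norm_lt one_pos, hD.eventually_norm_lt (div_pos hδ hy)]
    with ε hMε h1 h2
  have hfy := pow_pos (hpos y hy) n
  rw [← mul_le_mul_iff_of_pos_left hfy, ← hMε y hy, powerAverage, ← integral_const_mul]
  refine setIntegral_mono_on (hD.integrableOn_prod_comp hf h1 hy)
    ((hD.integrableOn_prod_rpow h1 l).const_mul _)
    (hD.isClosed_centeredSublevel ε).measurableSet fun v hv => ?_
  rw [← prod_gamma_form f l β y (h1 v hv)]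
  refine Finset.prod_le_prod (fun i _ => ?_) fun i _ => ?_
  · exact (hpos _ (mul_pos hy (one_add_centered_pos (h1 v hv) i))).le
  have hs := one_add_centered_pos (h1 v hv) i
  rw [eq_mul_rpow_mul_exp hpos l β hy hs]
  refine mul_le_of_le_one_right ?_ (Real.exp_le_one_iff.2 (sub_nonpos.2 (hball ?_)))
  · have := hpos y hy
    positivity
  · have h3 : |v.1 i| * y < δ := by
      rw [← lt_div_iff₀ hy]
      exact (abs_centered_apply_le v i).trans_lt (h2 v hv)
    rw [Real.dist_eq, show y * (1 + v.1 i) - y = v.1 i * y by ring, abs_mul, abs_of_pos hy]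
    exact h3

/-- If `x ^ (-l) * exp (β x)` touches `f` from below at `y`, up to a constant factor, the constants
in the identity for `f` are at least those of the power `x ^ (-l)`. -/
lemma IsDispersion.eventually_powerAverage_le (hD : IsDispersion D)
    (hf : ContinuousOn f (Ioi 0)) (hpos : ∀ x, 0 < x → 0 < f x)
    (hM : ∀ᶠ ε in nhdsWithin (0 : ℝ) (Ioi 0), ∀ t, 0 < t →
      ∫ v in centeredSublevel D ε, ∏ i, f (t * (1 + v.1 i)) ∂centeredHaar n = f t ^ n * M ε)
    (hy : 0 < y)
    (hmin : IsLocalMin (fun y => Real.log (f y) + l * Real.log y - β * y) y) :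
    ∀ᶠ ε in nhdsWithin (0 : ℝ) (Ioi 0), powerAverage D l ε ≤ M ε := by
  obtain ⟨δ, hδ, hball⟩ := Metric.eventually_nhds_iff.1 hmin
  filter_upwards [hM, hD.eventually_norm_lt one_pos, hD.eventually_norm_lt (div_pos hδ hy)]
    with ε hMε h1 h2
  have hfy := pow_pos (hpos y hy) n
  rw [← mul_le_mul_iff_of_pos_left hfy, ← hMε y hy, powerAverage, ← integral_const_mul]
  refine setIntegral_mono_on ((hD.integrableOn_prod_rpow h1 l).const_mul _)
    (hD.integrableOn_prod_comp hf h1 hy)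
    (hD.isClosed_centeredSublevel ε).measurableSet fun v hv => ?_
  rw [← prod_gamma_form f l β y (h1 v hv)]
  have hnonneg : ∀ i, 0 ≤ f y * (1 + v.1 i) ^ (-l) * Real.exp (β * y * v.1 i) := fun i => by
    have := hpos y hy
    have hs := one_add_centered_pos (h1 v hv) i
    positivity
  refine Finset.prod_le_prod (fun i _ => hnonneg i) fun i _ => ?_
  have hs := one_add_centered_pos (h1 v hv) i
  rw [eq_mul_rpow_mul_exp hpos l β hy hs]
  refine le_mul_of_one_le_right (hnonneg i) (Real.one_le_exp_iff.2 (sub_nonneg.2 (hball ?_)))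
  have h3 : |v.1 i| * y < δ := by
    rw [← lt_div_iff₀ hy]
    exact (abs_centered_apply_le v i).trans_lt (h2 v hv)
  rw [Real.dist_eq, show y * (1 + v.1 i) - y = v.1 i * y by ring, abs_mul, abs_of_pos hy]
  exact h3

/-- A positive continuous `f` whose products `∏ f (t (1 + v i))`, integrated over small sublevel
sets, are proportional to `f t ^ n` has the shape of a gamma density. -/
theorem IsDispersion.exists_eq_gamma_form (hD : IsDispersion D) (hn : 2 ≤ n)
    (hf : ContinuousOn f (Ioi 0)) (hpos : ∀ x, 0 < x → 0 < f x)
    (hM : ∀ᶠ ε in nhdsWithin (0 : ℝ) (Ioi 0), ∀ t, 0 < t →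
      ∫ v in centeredSublevel D ε, ∏ i, f (t * (1 + v.1 i)) ∂centeredHaar n = f t ^ n * M ε) :
    ∃ l β γ : ℝ, ∀ x, 0 < x → f x = Real.exp γ * (x ^ (-l) * Real.exp (β * x)) := by
  have hcont : ∀ l : ℝ, ContinuousOn (fun y => Real.log (f y) + l * Real.log y) (Ioi 0) :=
    fun l => (hf.log fun x hx => (hpos x hx).ne').add
      (continuousOn_const.mul (Real.continuousOn_log.mono fun x hx => (mem_Ioi.1 hx).ne'))
  obtain ⟨l, β, γ, h⟩ := exists_eq_log_add_affine (k := fun y => Real.log (f y)) (by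
    intro l l' hll
    by_contra! hno
    obtain ⟨β, y, hy, hmax⟩ := exists_isLocalMax_of_not_convexOn (hcont l) hno.1
    obtain ⟨β', y', hy', hmin⟩ := exists_isLocalMin_of_not_concaveOn (hcont l') hno.2
    obtain ⟨ε, hε0, h1, h2, h3⟩ := (
      (eventually_mem_nhdsWithin : ∀ᶠ ε in nhdsWithin (0 : ℝ) (Ioi 0), ε ∈ Ioi 0).and
      ((hD.eventually_norm_lt one_pos).and
        ((hD.eventually_le_powerAverage hf hpos hM hy hmax).and
          (hD.eventually_powerAverage_le hf hpos hM hy' hmin)))).exists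
    exact absurd (h3.trans h2) (hD.powerAverage_lt hn hε0 h1 hll).not_ge)
  refine ⟨l, β, γ, fun x hx => ?_⟩
  rw [← Real.exp_log (hpos x hx), h x hx, Real.rpow_def_of_pos hx, ← Real.exp_add, ← Real.exp_add]
  congr 1
  ring

end Comparison

/-! ### The joint law of the mean and the scale-free dispersion -/

/-- Independence of two functions of a random element, expressed through its law. -/
lemma indepFun_comp_iff_map {Ω S : Type*} [MeasurableSpace Ω] [MeasurableSpace S]
    {P : Measure Ω} {Y : Ω → S} (hY : AEMeasurable Y P) {φ ψ : S → ℝ} (hφ : Measurable φ)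
    (hψ : Measurable ψ) :
    IndepFun (fun ω => φ (Y ω)) (fun ω => ψ (Y ω)) P ↔
      ∀ A B : Set ℝ, MeasurableSet A → MeasurableSet B →
        P.map Y (φ ⁻¹' A ∩ ψ ⁻¹' B) = P.map Y (φ ⁻¹' A) * P.map Y (ψ ⁻¹' B) := by
  rw [indepFun_iff_measure_inter_preimage_eq_mul]
  refine forall_congr' fun A => forall_congr' fun B => forall_congr' fun hA =>
    forall_congr' fun hB => ?_
  rw [Measure.map_apply_of_aemeasurable hY ((hφ hA).inter (hψ hB)),
    Measure.map_apply_of_aemeasurable hY (hφ hA), Measure.map_apply_of_aemeasurable hY (hψ hB)]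
  rfl

lemma sampleMean_mul_one_add_centered {n : ℕ} (hn : 0 < n) (t : ℝ) (v : centered n) :
    sampleMean (fun i => t * (1 + v.1 i)) = t := by
  have h : (fun i => t * (1 + v.1 i)) = t • fun i => v.1 i + 1 := by
    funext i; simp [add_comm]
  rw [h, sampleMean_smul, sampleMean_add_const hn, sampleMean_centered, zero_add, mul_one]

lemma IsDispersion.map_mul_one_add {n : ℕ} {D : (Fin n → ℝ) → ℝ} (hD : IsDispersion D) {t : ℝ}
    (ht : 0 < t) (v : Fin n → ℝ) : D (fun i => t * (1 + v i)) = t * D v := by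
  have h : (fun i => t * (1 + v i)) = t • fun i => v i + 1 := by
    funext i; simp [add_comm]
  rw [h, hD.map_smul t ht, hD.map_add_const]

lemma measurable_div_sampleMean {n : ℕ} {D : (Fin n → ℝ) → ℝ} (hD : IsDispersion D) :
    Measurable fun x => D x / sampleMean x :=
  hD.continuous.measurable.div continuous_sampleMean.measurable

lemma exists_nonpos_of_sampleMean_nonpos {n : ℕ} (hn : 0 < n) {x : Fin n → ℝ}
    (h : sampleMean x ≤ 0) : ∃ i, x i ≤ 0 := by
  by_contra! hx
  have : Nonempty (Fin n) := ⟨⟨0, hn⟩⟩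
  have h1 : 0 < ∑ i, x i := Finset.sum_pos (fun i _ => hx i) Finset.univ_nonempty
  have : 0 < sampleMean x := div_pos h1 (by exact_mod_cast hn)
  linarith

/-- The joint law of the mean and of the scale-free dispersion of a positive sample with density
`ρ`. -/
lemma exists_joint_law {n : ℕ} (hn : 0 < n) :
    ∃ c : ENNReal, c ≠ 0 ∧ c ≠ ⊤ ∧ ∃ d : ℕ, ∀ (D : (Fin n → ℝ) → ℝ), IsDispersion D →
      ∀ ρ : ℝ → ENNReal, Measurable ρ → (∀ x, x ≤ 0 → ρ x = 0) →
      IsProbabilityMeasure (volume.withDensity ρ) →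
      ∀ A B : Set ℝ, MeasurableSet A → MeasurableSet B →
        Measure.pi (fun _ : Fin n => volume.withDensity ρ)
          (sampleMean ⁻¹' A ∩ (fun x => D x / sampleMean x) ⁻¹' B) =
        c * ∫⁻ t in A, (Ioi (0 : ℝ)).indicator (fun t => ENNReal.ofReal (t ^ d) *
          ∫⁻ v in {v | D v.1 ∈ B}, ∏ i, ρ (t * (1 + v.1 i)) ∂centeredHaar n) t := by
  obtain ⟨c, hc0, hct, d, h⟩ := exists_lintegral_eq_polar hn
  refine ⟨c, hc0, hct, d, fun D hD ρ hρ hρ0 hprob A B hA hB => ?_⟩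
  have hS : MeasurableSet (sampleMean ⁻¹' A ∩ (fun x : Fin n → ℝ => D x / sampleMean x) ⁻¹' B) :=
    (continuous_sampleMean.measurable hA).inter (measurable_div_sampleMean hD hB)
  have hprod : Measurable fun x : Fin n → ℝ => ∏ i, ρ (x i) :=
    Finset.measurable_prod _ fun i _ => hρ.comp (measurable_pi_apply i)
  have hBm : MeasurableSet {v : centered n | D v.1 ∈ B} := hD.continuous_centered.measurable hB
  rw [pi_withDensity hρ, withDensity_apply _ hS, ← lintegral_indicator hS,
    h _ (hprod.indicator hS) ?_]
  · congr 1
    rw [← lintegral_indicator measurableSet_Ioi, ← lintegral_indicator hA]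
    refine lintegral_congr fun t => ?_
    by_cases ht : t ∈ Ioi (0 : ℝ)
    · have ht' : 0 < t := ht
      have hmem : ∀ v : centered n, (fun i => t * (1 + v.1 i)) ∈ sampleMean ⁻¹' A ∩
          (fun x : Fin n → ℝ => D x / sampleMean x) ⁻¹' B ↔ t ∈ A ∧ D v.1 ∈ B := by
        intro v
        rw [mem_inter_iff, mem_preimage, mem_preimage, sampleMean_mul_one_add_centered hn,
          hD.map_mul_one_add ht', mul_div_cancel_left₀ _ ht'.ne']
      rw [indicator_of_mem ht]
      by_cases hA' : t ∈ A
      · rw [indicator_of_mem hA', indicator_of_mem ht, ← lintegral_indicator hBm]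
        congr 1
        refine lintegral_congr fun v => ?_
        by_cases hv : D v.1 ∈ B
        · have hv' : v ∈ {v : centered n | D v.1 ∈ B} := hv
          rw [indicator_of_mem ((hmem v).2 ⟨hA', hv⟩), indicator_of_mem hv']
        · have hv' : v ∉ {v : centered n | D v.1 ∈ B} := hv
          rw [indicator_of_notMem fun hc => hv ((hmem v).1 hc).2, indicator_of_notMem hv']
      · rw [indicator_of_notMem hA']
        refine (mul_eq_zero.2 (Or.inr ?_))
        rw [← lintegral_zero (μ := centeredHaar n)]
        exact lintegral_congr fun v => indicator_of_notMem (fun hc => hA' ((hmem v).1 hc).1) _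
    · rw [indicator_of_notMem ht]
      by_cases hA' : t ∈ A
      · rw [indicator_of_mem hA', indicator_of_notMem ht]
      · rw [indicator_of_notMem hA']
  · intro x hx
    obtain ⟨i, hi⟩ := exists_nonpos_of_sampleMean_nonpos hn hx
    rw [indicator_apply_eq_zero]
    exact fun _ => Finset.prod_eq_zero (Finset.mem_univ i) (hρ0 _ hi)

/-- If the angular and radial parts of the density of the sample separate, the mean is independent
of the scale-free dispersion. -/
theorem measure_inter_eq_mul_of_separated {n : ℕ} (hn : 0 < n) {D : (Fin n → ℝ) → ℝ}
    (hD : IsDispersion D) {ρ : ℝ → ENNReal} (hρ : Measurable ρ) (hρ0 : ∀ x, x ≤ 0 → ρ x = 0)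
    [hprob : IsProbabilityMeasure (volume.withDensity ρ)] {k w : ℝ → ENNReal} (hk : Measurable k)
    (hsep : ∀ t, 0 < t → ∀ v : centered n,
      ∏ i, ρ (t * (1 + v.1 i)) = k t * ∏ i, w (1 + v.1 i)) (hw : Measurable w)
    {A B : Set ℝ} (hA : MeasurableSet A) (hB : MeasurableSet B) :
    Measure.pi (fun _ : Fin n => volume.withDensity ρ)
        (sampleMean ⁻¹' A ∩ (fun x => D x / sampleMean x) ⁻¹' B) =
      Measure.pi (fun _ : Fin n => volume.withDensity ρ) (sampleMean ⁻¹' A) *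
        Measure.pi (fun _ : Fin n => volume.withDensity ρ)
          ((fun x => D x / sampleMean x) ⁻¹' B) := by
  obtain ⟨c, -, -, d, hc⟩ := exists_joint_law hn
  set Q := Measure.pi (fun _ : Fin n => volume.withDensity ρ) with hQ
  set α : Set ℝ → ENNReal := fun A => c * ∫⁻ t in A, (Ioi (0 : ℝ)).indicator
    (fun t => ENNReal.ofReal (t ^ d) * k t) t with hα
  set H : Set ℝ → ENNReal := fun B => ∫⁻ v in {v : centered n | D v.1 ∈ B},
    ∏ i, w (1 + v.1 i) ∂centeredHaar n with hH
  have hwm : Measurable fun v : centered n => ∏ i, w (1 + v.1 i) :=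
    Finset.measurable_prod _ fun i _ => hw.comp
      (continuous_const.add (continuous_centered_apply i)).measurable
  have key : ∀ A B : Set ℝ, MeasurableSet A → MeasurableSet B →
      Q (sampleMean ⁻¹' A ∩ (fun x => D x / sampleMean x) ⁻¹' B) = α A * H B := by
    intro A B hA hB
    rw [hQ, hc D hD ρ hρ hρ0 hprob A B hA hB, hα, mul_assoc]
    congr 1
    rw [← lintegral_mul_const]
    · refine lintegral_congr fun t => ?_
      by_cases ht : t ∈ Ioi (0 : ℝ)
      · rw [indicator_of_mem ht, indicator_of_mem ht, mul_assoc]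
        congr 1
        simp only [hsep t ht]
        exact lintegral_const_mul _ hwm
      · simp [indicator_of_notMem ht]
    · refine Measurable.indicator (Measurable.mul ?_ hk) measurableSet_Ioi
      fun_prop
  have h1 := key A univ hA MeasurableSet.univ
  have h2 := key univ B MeasurableSet.univ hB
  have h3 := key univ univ MeasurableSet.univ MeasurableSet.univ
  simp only [preimage_univ, inter_univ, univ_inter, measure_univ] at h1 h2 h3
  rw [key A B hA hB, h1, h2]
  calc α A * H B = α A * H B * (α univ * H univ) := by rw [← h3, mul_one]
    _ = _ := by ring

/-- Independence makes the conditional laws of the scale-free dispersion given the mean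
constant. -/
theorem ae_lintegral_eq_mul_of_indep {n : ℕ} (hn : 0 < n) {D : (Fin n → ℝ) → ℝ}
    (hD : IsDispersion D) {ρ : ℝ → ENNReal} (hρ : Measurable ρ) (hρ0 : ∀ x, x ≤ 0 → ρ x = 0)
    [hprob : IsProbabilityMeasure (volume.withDensity ρ)] {B : Set ℝ} (hB : MeasurableSet B)
    (hind : ∀ A : Set ℝ, MeasurableSet A →
      Measure.pi (fun _ : Fin n => volume.withDensity ρ)
          (sampleMean ⁻¹' A ∩ (fun x => D x / sampleMean x) ⁻¹' B) =
        Measure.pi (fun _ : Fin n => volume.withDensity ρ) (sampleMean ⁻¹' A) *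
          Measure.pi (fun _ : Fin n => volume.withDensity ρ)
            ((fun x => D x / sampleMean x) ⁻¹' B)) :
    ∀ᵐ t ∂volume.restrict (Ioi (0 : ℝ)),
      ∫⁻ v in {v | D v.1 ∈ B}, ∏ i, ρ (t * (1 + v.1 i)) ∂centeredHaar n =
        Measure.pi (fun _ : Fin n => volume.withDensity ρ)
            ((fun x => D x / sampleMean x) ⁻¹' B) *
          ∫⁻ v, ∏ i, ρ (t * (1 + v.1 i)) ∂centeredHaar n := by
  obtain ⟨c, hc0, hct, d, hc⟩ := exists_joint_law hn
  set p := Measure.pi (fun _ : Fin n => volume.withDensity ρ)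
    ((fun x => D x / sampleMean x) ⁻¹' B)
  have hmeas : ∀ C : Set ℝ, Measurable ((Ioi (0 : ℝ)).indicator fun t => ENNReal.ofReal (t ^ d) *
      ∫⁻ v in {v | D v.1 ∈ C}, ∏ i, ρ (t * (1 + v.1 i)) ∂centeredHaar n) := by
    intro C
    refine Measurable.indicator (Measurable.mul (by fun_prop) ?_) measurableSet_Ioi
    refine Measurable.lintegral_prod_right' (f := fun q : ℝ × centered n =>
      ∏ i, ρ (q.1 * (1 + q.2.1 i))) (Finset.measurable_prod _ fun i _ => hρ.comp ?_)
    exact (continuous_fst.mul (continuous_const.add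
      ((continuous_centered_apply i).comp continuous_snd))).measurable
  have hae := ae_eq_of_forall_setLIntegral_eq_of_sigmaFinite (μ := (volume : Measure ℝ))
    (hmeas B) ((hmeas univ).const_mul p) (fun A hA _ => by
      have h1 := hind A hA
      have h2 := hc D hD ρ hρ hρ0 hprob A univ hA MeasurableSet.univ
      rw [preimage_univ, inter_univ] at h2
      rw [hc D hD ρ hρ hρ0 hprob A B hA hB, h2, mul_assoc] at h1
      rw [lintegral_const_mul _ (hmeas univ), mul_comm p]
      exact (ENNReal.mul_right_inj hc0 hct).1 h1)
  rw [ae_restrict_iff' measurableSet_Ioi]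
  filter_upwards [hae] with t ht h0
  rw [indicator_of_mem h0, indicator_of_mem h0, mul_left_comm] at ht
  have hpos : 0 < t ^ d := pow_pos h0 d
  have := (ENNReal.mul_right_inj (ENNReal.ofReal_pos.2 hpos).ne' ENNReal.ofReal_ne_top).1 ht
  simpa using this

/-! ### From proportionality almost everywhere to a pointwise identity -/

section Radial

variable {n : ℕ} {D : (Fin n → ℝ) → ℝ} {f : ℝ → ℝ} {ε : ℝ}

lemma IsDispersion.continuousOn_integral_prod (hD : IsDispersion D)
    (hf : ContinuousOn f (Ioi 0)) (hε : ∀ v ∈ centeredSublevel D ε, ‖v‖ < 1) :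
    ContinuousOn (fun t => ∫ v in centeredSublevel D ε, ∏ i, f (t * (1 + v.1 i)) ∂centeredHaar n)
      (Ioi 0) := by
  have hKm := (hD.isClosed_centeredSublevel ε).measurableSet
  intro t₀ ht₀
  have ht₀' : 0 < t₀ := ht₀
  refine ContinuousAt.continuousWithinAt ?_
  have hsub : Icc (t₀ / 2) (2 * t₀) ×ˢ centeredSublevel D ε ⊆ Ioi 0 ×ˢ centeredSublevel D ε :=
    prod_mono (fun t ht => lt_of_lt_of_le (by positivity) ht.1) subset_rfl
  obtain ⟨C, hC⟩ := (isCompact_Icc.prod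
    (hD.isCompact_centeredSublevel ε)).exists_bound_of_continuousOn
    ((continuousOn_prod_mul_one_add hf hε).mono hsub)
  have hnear : ∀ᶠ t in nhds t₀, t ∈ Icc (t₀ / 2) (2 * t₀) :=
    Icc_mem_nhds (by linarith) (by linarith)
  refine continuousAt_of_dominated (bound := fun _ => C) ?_ ?_ ?_ ?_
  · filter_upwards [hnear] with t ht
    exact (continuousOn_prod_mul_one_add_right hf hε
      (lt_of_lt_of_le (by positivity) ht.1)).aestronglyMeasurable hKm
  · filter_upwards [hnear] with t ht
    filter_upwards [ae_restrict_mem hKm] with v hv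
    exact hC (t, v) ⟨ht, hv⟩
  · exact integrableOn_const (hD.measure_centeredSublevel_lt_top ε).ne
  · filter_upwards [ae_restrict_mem hKm] with v hv
    refine tendsto_finsetProd _ fun i _ => ?_
    have hp : 0 < t₀ * (1 + v.1 i) := mul_pos ht₀' (one_add_centered_pos (hε v hv) i)
    exact ContinuousAt.comp (f := fun t => t * (1 + v.1 i)) (hf.continuousAt (Ioi_mem_nhds hp))
      (by fun_prop)

/-- Averages of `∏ f (t (1 + v i))` over shrinking sublevel sets converge to `f t ^ n`. -/
lemma IsDispersion.tendsto_average_prod (hD : IsDispersion D)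
    (hf : ContinuousOn f (Ioi 0)) {t : ℝ} (ht : 0 < t) :
    Filter.Tendsto (fun ε =>
      (∫ v in centeredSublevel D ε, ∏ i, f (t * (1 + v.1 i)) ∂centeredHaar n) /
      (centeredHaar n).real (centeredSublevel D ε)) (nhdsWithin 0 (Ioi 0)) (nhds (f t ^ n)) := by
  have hcont : ContinuousAt (fun v : centered n => ∏ i, f (t * (1 + v.1 i))) 0 := by
    refine tendsto_finsetProd _ fun i _ => ?_
    have hp : 0 < t * (1 + (0 : centered n).1 i) := by simpa using ht
    exact ContinuousAt.comp (f := fun v : centered n => t * (1 + v.1 i))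
      (hf.continuousAt (Ioi_mem_nhds hp))
      (continuous_const.mul (continuous_const.add (continuous_centered_apply i))).continuousAt
  rw [Metric.tendsto_nhds]
  intro δ hδ
  obtain ⟨r, hr, hball⟩ := Metric.continuousAt_iff.1 hcont (δ / 2) (half_pos hδ)
  filter_upwards [hD.eventually_norm_lt one_pos, hD.eventually_norm_lt hr,
    self_mem_nhdsWithin] with ε h1 h2 hε
  have hlt := hD.measure_centeredSublevel_lt_top ε
  have hm : 0 < (centeredHaar n).real (centeredSublevel D ε) :=
    ENNReal.toReal_pos (hD.measure_centeredSublevel_pos hε).ne' hlt.ne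
  have hbound := norm_setIntegral_le_of_norm_le_const hlt (C := δ / 2)
    (f := fun v : centered n => ∏ i, f (t * (1 + v.1 i)) - f t ^ n) (fun v hv => by
      have := hball (x := v) (by simpa using h2 v hv)
      simpa [Real.dist_eq] using this.le)
  rw [integral_sub (hD.integrableOn_prod_comp hf h1 ht) (integrableOn_const hlt.ne),
    setIntegral_const, smul_eq_mul, Real.norm_eq_abs] at hbound
  rw [Real.dist_eq]
  calc _ = |(∫ v in centeredSublevel D ε, ∏ i, f (t * (1 + v.1 i)) ∂centeredHaar n) -
        (centeredHaar n).real (centeredSublevel D ε) * f t ^ n| /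
          (centeredHaar n).real (centeredSublevel D ε) := by
        rw [← abs_of_pos hm, ← abs_div, abs_of_pos hm]
        congr 1
        field_simp
    _ ≤ δ / 2 := by rwa [div_le_iff₀ hm]
    _ < δ := half_lt_self hδ

/-- The extended integral against the density extended by `0` agrees with the real one, as small
centered vectors keep the sample positive. -/
lemma IsDispersion.lintegral_eq_ofReal (hD : IsDispersion D)
    (hf : ContinuousOn f (Ioi 0)) (hpos : ∀ x, 0 < x → 0 < f x)
    (hε : ∀ v ∈ centeredSublevel D ε, ‖v‖ < 1) {t : ℝ} (ht : 0 < t) :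
    ∫⁻ v in centeredSublevel D ε, ∏ i, (Ioi (0 : ℝ)).indicator
        (fun x => ENNReal.ofReal (f x)) (t * (1 + v.1 i)) ∂centeredHaar n =
      ENNReal.ofReal
        (∫ v in centeredSublevel D ε, ∏ i, f (t * (1 + v.1 i)) ∂centeredHaar n) := by
  have hKm := (hD.isClosed_centeredSublevel ε).measurableSet
  have hp : ∀ v ∈ centeredSublevel D ε, ∀ i, 0 < t * (1 + v.1 i) := fun v hv i =>
    mul_pos ht (one_add_centered_pos (hε v hv) i)
  rw [ofReal_integral_eq_lintegral_ofReal (hD.integrableOn_prod_comp hf hε ht)]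
  · refine setLIntegral_congr_fun hKm fun v hv => ?_
    rw [ENNReal.ofReal_prod_of_nonneg fun i _ => (hpos _ (hp v hv i)).le]
    exact Finset.prod_congr rfl fun i _ => indicator_of_mem (mem_Ioi.2 (hp v hv i)) _
  · filter_upwards [ae_restrict_mem hKm] with v hv
    exact Finset.prod_nonneg fun i _ => (hpos _ (hp v hv i)).le

lemma IsDispersion.integral_prod_pos (hD : IsDispersion D)
    (hf : ContinuousOn f (Ioi 0)) (hpos : ∀ x, 0 < x → 0 < f x) (hε0 : 0 < ε)
    (hε : ∀ v ∈ centeredSublevel D ε, ‖v‖ < 1) {t : ℝ} (ht : 0 < t) :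
    0 < ∫ v in centeredSublevel D ε, ∏ i, f (t * (1 + v.1 i)) ∂centeredHaar n := by
  have hKm := (hD.isClosed_centeredSublevel ε).measurableSet
  have hp : ∀ v ∈ centeredSublevel D ε, 0 < ∏ i, f (t * (1 + v.1 i)) := fun v hv =>
    Finset.prod_pos fun i _ => hpos _ (mul_pos ht (one_add_centered_pos (hε v hv) i))
  rw [setIntegral_pos_iff_support_of_nonneg_ae]
  · exact (hD.measure_centeredSublevel_pos hε0).trans_le
      (measure_mono fun v hv => ⟨(hp v hv).ne', hv⟩)
  · filter_upwards [ae_restrict_mem hKm] with v hv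
    exact (hp v hv).le
  · exact hD.integrableOn_prod_comp hf hε ht

/-- If for small `ε` the integrals over the sublevel sets are, for almost every `t`, a constant
times a function of `t` not depending on `ε`, then they are proportional to `f t ^ n`. -/
theorem IsDispersion.eventually_integral_eq_pow_mul (hD : IsDispersion D)
    (hf : ContinuousOn f (Ioi 0)) (hpos : ∀ x, 0 < x → 0 < f x) {p : ℝ → ENNReal}
    (hp : ∀ ε, p ε ≠ ⊤) {g : ℝ → ENNReal}
    (h : ∀ ε, ∀ᵐ t ∂volume.restrict (Ioi (0 : ℝ)),
      ∫⁻ v in centeredSublevel D ε, ∏ i, (Ioi (0 : ℝ)).indicator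
        (fun x => ENNReal.ofReal (f x)) (t * (1 + v.1 i)) ∂centeredHaar n = p ε * g t) :
    ∃ M : ℝ → ℝ, ∀ᶠ ε in nhdsWithin (0 : ℝ) (Ioi 0), ∀ t, 0 < t →
      ∫ v in centeredSublevel D ε, ∏ i, f (t * (1 + v.1 i)) ∂centeredHaar n = f t ^ n * M ε := by
  set I : ℝ → ℝ → ℝ := fun ε t =>
    ∫ v in centeredSublevel D ε, ∏ i, f (t * (1 + v.1 i)) ∂centeredHaar n with hI
  have hae : ∀ ε, (∀ v ∈ centeredSublevel D ε, ‖v‖ < 1) →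
      ∀ᵐ t ∂volume.restrict (Ioi (0 : ℝ)), ENNReal.ofReal (I ε t) = p ε * g t := by
    intro ε hε
    filter_upwards [h ε, ae_restrict_mem measurableSet_Ioi] with t h1 ht
    rw [← h1, hD.lintegral_eq_ofReal hf hpos hε ht]
  have hp0 : ∀ ε, 0 < ε → (∀ v ∈ centeredSublevel D ε, ‖v‖ < 1) → (p ε).toReal ≠ 0 := by
    intro ε hε0 hε
    have : (ae (volume.restrict (Ioi (0 : ℝ)))).NeBot := by
      rw [ae_neBot, ne_eq, Measure.restrict_eq_zero]
      simp
    obtain ⟨t, h1, ht⟩ := ((hae ε hε).and (ae_restrict_mem measurableSet_Ioi)).exists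
    have h2 := ENNReal.ofReal_pos.2 (hD.integral_prod_pos hf hpos hε0 hε ht)
    refine (ENNReal.toReal_pos (fun h0 => ?_) (hp ε)).ne'
    rw [h0, zero_mul] at h1
    exact h2.ne' h1
  have hprop : ∀ ε ε', (∀ v ∈ centeredSublevel D ε, ‖v‖ < 1) →
      (∀ v ∈ centeredSublevel D ε', ‖v‖ < 1) → ∀ t, 0 < t →
      I ε t * (p ε').toReal = I ε' t * (p ε).toReal := by
    intro ε ε' hε hε'
    have hnn : ∀ ε, (∀ v ∈ centeredSublevel D ε, ‖v‖ < 1) → ∀ t, 0 < t → 0 ≤ I ε t := by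
      intro ε hε t ht
      refine setIntegral_nonneg (hD.isClosed_centeredSublevel ε).measurableSet fun v hv => ?_
      exact Finset.prod_nonneg fun i _ =>
        (hpos _ (mul_pos ht (one_add_centered_pos (hε v hv) i))).le
    refine Measure.eqOn_open_of_ae_eq (μ := volume) (U := Ioi (0 : ℝ)) ?_ isOpen_Ioi
      ((hD.continuousOn_integral_prod hf hε).mul continuousOn_const)
      ((hD.continuousOn_integral_prod hf hε').mul continuousOn_const)
    filter_upwards [hae ε hε, hae ε' hε', ae_restrict_mem measurableSet_Ioi] with t h1 h2 ht
    have e : ENNReal.ofReal (I ε t) * p ε' = ENNReal.ofReal (I ε' t) * p ε := by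
      rw [h1, h2]; ring
    have := congrArg ENNReal.toReal e
    rwa [ENNReal.toReal_mul, ENNReal.toReal_mul, ENNReal.toReal_ofReal (hnn ε hε t ht),
      ENNReal.toReal_ofReal (hnn ε' hε' t ht)] at this
  refine ⟨fun ε => I ε 1 / f 1 ^ n, ?_⟩
  have hsmall : ∀ᶠ ε in nhdsWithin (0 : ℝ) (Ioi 0),
      0 < ε ∧ ∀ v ∈ centeredSublevel D ε, ‖v‖ < 1 :=
    (eventually_mem_nhdsWithin : ∀ᶠ ε in nhdsWithin (0 : ℝ) (Ioi 0), ε ∈ Ioi 0).and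
      (hD.eventually_norm_lt one_pos)
  filter_upwards [hsmall] with ε hε t ht
  -- Divide `I ε t * I ε' 1 = I ε 1 * I ε' t` by the measure of the sublevel set of `ε'`, and let
  -- `ε'` tend to `0`.
  have hlim : I ε t * f 1 ^ n = I ε 1 * f t ^ n := by
    refine tendsto_nhds_unique ((hD.tendsto_average_prod hf one_pos).const_mul (I ε t)) ?_
    refine ((hD.tendsto_average_prod hf ht).const_mul (I ε 1)).congr' ?_
    filter_upwards [hsmall] with ε' hε'
    have h1 := hprop ε ε' hε.2 hε'.2 t ht
    have h2 := hprop ε ε' hε.2 hε'.2 1 one_pos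
    have h3 := hp0 ε hε.1 hε.2
    have h4 := hp0 ε' hε'.1 hε'.2
    change I ε 1 * (I ε' t / _) = I ε t * (I ε' 1 / _)
    rw [← mul_div_assoc, ← mul_div_assoc]
    congr 1
    refine mul_right_cancel₀ (mul_ne_zero h3 h4) ?_
    linear_combination (I ε' t * (p ε).toReal) * h2 - (I ε' 1 * (p ε).toReal) * h1
  have hf1 : f 1 ^ n ≠ 0 := (pow_pos (hpos 1 one_pos) n).ne'
  change I ε t = _
  field_simp
  linarith

end Radial

/-! ### Gamma distributions -/

lemma gammaMeasure_eq_withDensity_indicator (a r : ℝ) :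
    gammaMeasure a r = volume.withDensity ((Ioi (0 : ℝ)).indicator (gammaPDF a r)) := by
  refine withDensity_congr_ae ?_
  -- The densities may differ at `0`.
  have h0 : ∀ᵐ x : ℝ, x ≠ 0 := by simp [ae_iff]
  filter_upwards [h0] with x hx
  by_cases h : 0 < x
  · rw [indicator_of_mem (mem_Ioi.2 h)]
  · rw [indicator_of_notMem (by simpa using h)]
    exact gammaPDF_of_neg (lt_of_le_of_ne (not_lt.1 h) hx)

/-- A probability density on `(0, ∞)` of the form `x ^ (-l) * exp (β x)`, up to normalization, is a
gamma density: integrability forces the signs of the parameters. -/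
theorem isGammaDistribution_of_density {F : Measure ℝ} [IsProbabilityMeasure F] {f : ℝ → ℝ}
    (hF : F = (volume.restrict (Ioi 0)).withDensity (fun x => ENNReal.ofReal (f x)))
    {l β γ : ℝ} (hf : ∀ x, 0 < x → f x = Real.exp γ * (x ^ (-l) * Real.exp (β * x))) :
    IsGammaDistribution F := by
  have hcont : ContinuousOn (fun x : ℝ => x ^ (-l) * Real.exp (β * x)) (Ioi 0) :=
    (continuousOn_id.rpow_const fun x hx => Or.inl (mem_Ioi.1 hx).ne').mul (by fun_prop)
  have hint : IntegrableOn (fun x : ℝ => x ^ (-l) * Real.exp (β * x)) (Ioi 0) := by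
    have h1 : ∫⁻ x in Ioi 0, ENNReal.ofReal (f x) = 1 := by
      rw [← setLIntegral_univ, ← withDensity_apply _ MeasurableSet.univ, ← hF, measure_univ]
    have h2 : IntegrableOn (fun x : ℝ => Real.exp γ * (x ^ (-l) * Real.exp (β * x))) (Ioi 0) := by
      refine ⟨(continuousOn_const.mul hcont).aestronglyMeasurable measurableSet_Ioi, ?_⟩
      rw [hasFiniteIntegral_iff_ofReal]
      · rw [← setLIntegral_congr_fun measurableSet_Ioi
          fun x hx => congrArg ENNReal.ofReal (hf x hx), h1]
        exact ENNReal.one_lt_top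
      · filter_upwards [ae_restrict_mem measurableSet_Ioi] with x hx
        have : 0 < x := hx
        positivity
    have h3 := h2.const_mul (Real.exp γ)⁻¹
    refine h3.congr (Filter.Eventually.of_forall fun x => ?_)
    exact inv_mul_cancel_left₀ (Real.exp_pos γ).ne' _
  have hl : 0 < 1 - l := by
    have h1 : IntegrableOn (fun x : ℝ => x ^ (-l)) (Ioo 0 1) := by
      refine Integrable.mono' ((hint.mono_set Ioo_subset_Ioi_self).const_mul (Real.exp |β|)) ?_ ?_
      · exact (continuousOn_id.rpow_const fun x hx => Or.inl hx.1.ne').aestronglyMeasurable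
          measurableSet_Ioo
      · filter_upwards [ae_restrict_mem measurableSet_Ioo] with x hx
        have hx0 : 0 ≤ x ^ (-l) := Real.rpow_nonneg hx.1.le _
        rw [Real.norm_of_nonneg hx0, mul_left_comm, ← Real.exp_add]
        refine le_mul_of_one_le_right hx0 (Real.one_le_exp_iff.2 ?_)
        have := neg_abs_le (β * x)
        rw [abs_mul, abs_of_pos hx.1] at this
        nlinarith [abs_nonneg β, hx.2]
    rw [intervalIntegral.integrableOn_Ioo_rpow_iff one_pos] at h1
    linarith
  have hβ : β < 0 := by
    by_contra! hβ
    have h1 : IntegrableOn (fun x : ℝ => x ^ (-l)) (Ioi 0) := by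
      refine Integrable.mono' hint ?_ ?_
      · exact (continuousOn_id.rpow_const fun x hx => Or.inl
          (mem_Ioi.1 hx).ne').aestronglyMeasurable measurableSet_Ioi
      · filter_upwards [ae_restrict_mem measurableSet_Ioi] with x hx
        have hx' : 0 < x := hx
        rw [Real.norm_of_nonneg (Real.rpow_nonneg hx'.le _)]
        exact le_mul_of_one_le_right (Real.rpow_nonneg hx'.le _)
          (Real.one_le_exp_iff.2 (by positivity))
    exact not_integrableOn_Ioi_rpow _ h1
  have hr : 0 < -β := by linarith
  refine ⟨1 - l, (-β)⁻¹, hl, inv_pos.2 hr, ?_⟩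
  rw [inv_inv]
  have hprob := isProbabilityMeasure_gammaMeasure hl hr
  set κ := (-β) ^ (1 - l) / Real.Gamma (1 - l) with hκdef
  have hκ : 0 < κ := div_pos (Real.rpow_pos_of_pos hr _) (Real.Gamma_pos_of_pos hl)
  have hmul : F = ENNReal.ofReal (Real.exp γ / κ) • gammaMeasure (1 - l) (-β) := by
    rw [gammaMeasure_eq_withDensity_indicator, withDensity_indicator measurableSet_Ioi,
      ← withDensity_smul' _ _ ENNReal.ofReal_ne_top, hF]
    refine withDensity_congr_ae ?_
    filter_upwards [ae_restrict_mem measurableSet_Ioi] with x hx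
    have hx' : 0 < x := hx
    rw [Pi.smul_apply, gammaPDF_of_nonneg hx'.le, smul_eq_mul, ← ENNReal.ofReal_mul (by positivity),
      ← hκdef, hf x hx']
    congr 1
    rw [show (1 - l - 1 : ℝ) = -l by ring, show -(-β * x) = β * x by ring]
    field_simp
  have hone : ENNReal.ofReal (Real.exp γ / κ) = 1 := by
    have := congrArg (fun μ : Measure ℝ => μ univ) hmul
    simpa using this.symm
  rw [hmul, hone, one_smul]

/-- For a gamma sample the mean is independent of the scale-free dispersion. -/
theorem measure_inter_eq_mul_of_isGammaDistribution {n : ℕ} (hn : 0 < n)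
    {D : (Fin n → ℝ) → ℝ} (hD : IsDispersion D) {F : Measure ℝ} [hprob : IsProbabilityMeasure F]
    (hF : IsGammaDistribution F) {A B : Set ℝ} (hA : MeasurableSet A) (hB : MeasurableSet B) :
    Measure.pi (fun _ : Fin n => F)
        (sampleMean ⁻¹' A ∩ (fun x => D x / sampleMean x) ⁻¹' B) =
      Measure.pi (fun _ : Fin n => F) (sampleMean ⁻¹' A) *
        Measure.pi (fun _ : Fin n => F) ((fun x => D x / sampleMean x) ⁻¹' B) := by
  obtain ⟨a, b, ha, hb, rfl⟩ := hF
  have hr : 0 < b⁻¹ := inv_pos.2 hb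
  set r := b⁻¹
  rw [gammaMeasure_eq_withDensity_indicator] at hprob ⊢
  set κ := r ^ a / Real.Gamma a with hκdef
  have hκ : 0 < κ := div_pos (Real.rpow_pos_of_pos hr _) (Real.Gamma_pos_of_pos ha)
  have hm : Measurable ((Ioi (0 : ℝ)).indicator (gammaPDF a r)) :=
    (measurable_gammaPDFReal a r).ennreal_ofReal.indicator measurableSet_Ioi
  refine measure_inter_eq_mul_of_separated hn hD
    (k := fun t => ENNReal.ofReal (κ * t ^ (a - 1) * Real.exp (-(r * t))) ^ n)
    (w := (Ioi (0 : ℝ)).indicator fun x => ENNReal.ofReal (x ^ (a - 1)))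
    hm (fun x hx => indicator_of_notMem (by simpa using hx) _)
    (by fun_prop) ?_ (Measurable.indicator (by fun_prop) measurableSet_Ioi) hA hB
  intro t ht v
  by_cases hv : ∀ i, 0 < 1 + v.1 i
  · have h1 : ∀ i, (Ioi (0 : ℝ)).indicator (gammaPDF a r) (t * (1 + v.1 i)) =
        ENNReal.ofReal (κ * t ^ (a - 1) * Real.exp (-(r * t))) *
          (ENNReal.ofReal ((1 + v.1 i) ^ (a - 1)) *
            ENNReal.ofReal (Real.exp (-(r * t) * v.1 i))) := by
      intro i
      have hi := hv i
      have hp : 0 < t * (1 + v.1 i) := mul_pos ht hi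
      rw [indicator_of_mem (mem_Ioi.2 hp), gammaPDF_of_nonneg hp.le,
        ← ENNReal.ofReal_mul (by positivity), ← ENNReal.ofReal_mul (by positivity)]
      congr 1
      rw [Real.mul_rpow ht.le hi.le, ← hκdef,
        show -(r * (t * (1 + v.1 i))) = -(r * t) + -(r * t) * v.1 i by ring, Real.exp_add]
      ring
    -- The last exponential factors multiply to `1`, since `v` is centered.
    have h2 : ∏ i, ENNReal.ofReal (Real.exp (-(r * t) * v.1 i)) = 1 := by
      rw [← ENNReal.ofReal_prod_of_nonneg fun i _ => (Real.exp_pos _).le, ← Real.exp_sum,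
        ← Finset.mul_sum, sum_centered, mul_zero, Real.exp_zero, ENNReal.ofReal_one]
    rw [Finset.prod_congr rfl fun i _ => h1 i, Finset.prod_mul_distrib, Finset.prod_mul_distrib,
      h2, mul_one, Finset.prod_const, Finset.card_univ, Fintype.card_fin]
    congr 1
    refine Finset.prod_congr rfl fun i _ => ?_
    rw [indicator_of_mem (mem_Ioi.2 (hv i))]
  · push Not at hv
    obtain ⟨i, hi⟩ := hv
    have h1 : (Ioi (0 : ℝ)).indicator (gammaPDF a r) (t * (1 + v.1 i)) = 0 :=
      indicator_of_notMem (fun h => (mul_nonpos_of_nonneg_of_nonpos ht.le hi).not_gt h) _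
    have h2 : (Ioi (0 : ℝ)).indicator (fun x => ENNReal.ofReal (x ^ (a - 1))) (1 + v.1 i) = 0 :=
      indicator_of_notMem (fun h => hi.not_gt h) _
    rw [Finset.prod_eq_zero (Finset.mem_univ i) h1, Finset.prod_eq_zero (Finset.mem_univ i) h2,
      mul_zero]

/-! ### The characterization -/

/-- For a positive sample with continuous positive density, the mean and the scale-free dispersion
are independent exactly for gamma laws, whatever the measure of dispersion. -/
theorem IsDispersion.indepFun_iff_isGammaDistribution {n : ℕ} (hn : 2 ≤ n)
    {D : (Fin n → ℝ) → ℝ} (hD : IsDispersion D)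
    {Ω : Type*} [MeasurableSpace Ω] (P : Measure Ω) [IsProbabilityMeasure P]
    (F : Measure ℝ) (hF : HasPositiveContinuousDensity F)
    (X : Fin n → Ω → ℝ) (hlaw : ∀ i, HasLaw (X i) F P) (hindep : iIndepFun X P) :
    IndepFun (fun ω => sampleMean (fun i => X i ω))
        (fun ω => D (fun i => X i ω) / sampleMean (fun i => X i ω)) P ↔
      IsGammaDistribution F := by
  have hn0 : 0 < n := by omega
  have hXm : ∀ i, AEMeasurable (X i) P := fun i => (hlaw i).aemeasurable
  have hprob : IsProbabilityMeasure F := by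
    rw [← (hlaw ⟨0, hn0⟩).map_eq]
    exact Measure.isProbabilityMeasure_map (hXm _)
  have hmap : P.map (fun ω i => X i ω) = Measure.pi (fun _ => F) := by
    rw [(iIndepFun_iff_map_fun_eq_pi_map hXm).1 hindep]
    simp only [(hlaw _).map_eq]
  rw [indepFun_comp_iff_map (aemeasurable_pi_lambda _ hXm) continuous_sampleMean.measurable
    (measurable_div_sampleMean hD), hmap]
  refine ⟨fun h => ?_, fun h A B hA hB =>
    measure_inter_eq_mul_of_isGammaDistribution hn0 hD h hA hB⟩
  obtain ⟨f, hf, hpos, hFf⟩ := hF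
  set ρ : ℝ → ENNReal := (Ioi (0 : ℝ)).indicator fun x => ENNReal.ofReal (f x) with hρdef
  have hFρ : F = volume.withDensity ρ := by
    rw [hFf, withDensity_indicator measurableSet_Ioi]
  have hρ : Measurable ρ := by
    have h1 : ρ = fun x => ENNReal.ofReal ((Ioi (0 : ℝ)).indicator f x) := by
      funext x
      by_cases hx : x ∈ Ioi (0 : ℝ) <;> simp [hρdef, hx]
    rw [h1]
    refine Measurable.ennreal_ofReal ?_
    classical
    rw [← piecewise_eq_indicator]
    exact hf.measurable_piecewise continuousOn_const measurableSet_Ioi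
  have hρ0 : ∀ x, x ≤ 0 → ρ x = 0 := fun x hx => indicator_of_notMem (by simpa using hx) _
  have hprob' : IsProbabilityMeasure (volume.withDensity ρ) := hFρ ▸ hprob
  obtain ⟨M, hM⟩ := hD.eventually_integral_eq_pow_mul hf hpos
    (p := fun ε => Measure.pi (fun _ : Fin n => volume.withDensity ρ)
      ((fun x => D x / sampleMean x) ⁻¹' Iic ε))
    (fun ε => measure_ne_top _ _) fun ε =>
      ae_lintegral_eq_mul_of_indep hn0 hD hρ hρ0 measurableSet_Iic fun A hA => by
        have := h A (Iic ε) hA measurableSet_Iic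
        rwa [hFρ] at this
  obtain ⟨l, β, γ, hform⟩ := hD.exists_eq_gamma_form hn hf hpos hM
  exact isGammaDistribution_of_density hFf hform

theorem corollary2 {n : ℕ} (hn : 3 ≤ n)
    {Ω : Type*} [MeasurableSpace Ω] (P : Measure Ω) [IsProbabilityMeasure P]
    (F : Measure ℝ) (hF : HasPositiveContinuousDensity F)
    (X : Fin n → Ω → ℝ) (hlaw : ∀ i, HasLaw (X i) F P) (hindep : iIndepFun X P) :
    (∀ a : Fin n → ℝ, Monotone a → (∃ i j, a i ≠ a j) →
      (IndepFun (fun ω => sampleMean (fun i => X i ω))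
          (fun ω => orderedDeviation a (fun i => X i ω) / sampleMean (fun i => X i ω)) P ↔
        IsGammaDistribution F)) ∧
    (IndepFun (fun ω => sampleMean (fun i => X i ω))
        (fun ω => sampleRange (lt_of_lt_of_le zero_lt_three hn) (fun i => X i ω) /
          sampleMean (fun i => X i ω)) P ↔
      IsGammaDistribution F) ∧
    (IndepFun (fun ω => sampleMean (fun i => X i ω))
        (fun ω => giniMeanDifference (fun i => X i ω) / sampleMean (fun i => X i ω)) P ↔
      IsGammaDistribution F) := by
  have hn2 : 2 ≤ n := by omega
  exact ⟨fun a ha hne => (isDispersion_orderedDeviation ha hne).indepFun_iff_isGammaDistribution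
      hn2 P F hF X hlaw hindep,
    (isDispersion_sampleRange _ hn2).indepFun_iff_isGammaDistribution hn2 P F hF X hlaw hindep,
    (isDispersion_giniMeanDifference hn2).indepFun_iff_isGammaDistribution
      hn2 P F hF X hlaw hindep⟩
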